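/- Let $X\in\mathbb R^p$ and $Y\in\mathbb R^q$ be dependent random vectors, and let $(x_1,y_1),(x_2,y_2),\dots$ be independent copies of $(X,Y)$. Let $d_X(x,x')=\|x-x'\|_X$ and $d_Y(y,y')=\|y-y'\|_Y$, where $\|\cdot\|_X$ and $\|\cdot\|_Y$ are arbitrary norms on $\mathbb R^p$ and $\mathbb R^q$. For a sample of size $N$ and indices $i\ne j$, cross-classify the $N-2$ indices $k\notin\{i,j\}$ according to whether $d_X(x_i,x_k)\le d_X(x_i,x_j)$ (row 1) or not (row 2), and whether $d_Y(y_i,y_k)\le d_Y(y_i,y_j)$ (column 1) or not (column 2). Let $A_{ab}(i,j)$ be the resulting cell counts, with row sums $A_{a\cdot}(i,j)$ and column sums $A_{\cdot b}(i,j)$, and let $$S(i,j)=\frac{(N-2)\{A_{12}(i,j)A_{21}(i,j)-A_{11}(i,j)A_{22}(i,j)\}^2}{A_{1\cdot}(i,j)A_{2\cdot}(i,j)A_{\cdot1}(i,j)A_{\cdot2}(i,j)},$$ with $S(i,j)=0$ if one of the four margins is $0$. Let $T=\sum_{i=1}^N\sum_{j\ne i}S(i,j)$. The permutation $p$-value $\hat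 p_N$ is the fraction of the $N!$ permutations $\sigma$ of $\{1,\dots,N\}$ for which the statistic computed from $(x_1,y_{\sigma(1)}),\dots,(x_N,y_{\sigma(N)})$ is at least as large as the observed $T$. Then the permutation test is consistent, that is, $\Pr(\hat p_N\le\alpha)\to1$ as $N\to\infty$ for every $\alpha\in(0,1)$, in each of the following four cases. Densities are with respect to Lebesgue measure, a discrete vector is one with countable support, and for $x\in\mathbb R^p$ and $u\subseteq\{1,\dots,p\}$ we write $x(u)=(x_k)_{k\in u}$. 1. $(X,Y)$ has a joint density $h$. With $f$ and $g$ denoting densities of $X$ and of $Y$, there is a point $(x_0,y_0)$ with $h(x_0,y_0)\ne f(x_0)g(y_0)$ at which $h$ is continuous. 2. There are $u\subseteq\{1,\dots,p\}$ and $s\subseteq\{1,\dots,q\}$, with complements $v=u^c$ and $t=s^c$, such that at least one of $u,s$ is non-empty and both $v,t$ are non-empty; $X(u)$ and $Y(s)$ are discrete; and conditionally on each atom of $(X(u),Y(s))$ the vector $(X(v),Y(t))$ has a joint density $h(\cdot,\cdot\mid\cdot)$. Let $f(\cdot\mid a)$ and $g(\cdot\mid b)$ be densities of $X(v)$ given $X(u)=a$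 and of $Y(t)$ given $Y(s)=b$. There is a point $(x_0,y_0)$ such that: - with $a_0=x_0(u)$ and $b_0=y_0(s)$, $$\Pr(X(u)=a_0,Y(s)=b_0)\,h(x_0(v),y_0(t)\mid a_0,b_0)\ne \Pr(X(u)=a_0)\,f(x_0(v)\mid a_0)\,\Pr(Y(s)=b_0)\,g(y_0(t)\mid b_0);$$ - $(a_0,b_0)$ is an atom of $(X(u),Y(s))$, and some ball around it contains no other atom of $(X(u),Y(s))$; - $h(\cdot,\cdot\mid a_0,b_0)$ is continuous at $(x_0(v),y_0(t))$. 3. $X$ and $Y$ are both discrete. 4. $X$ is discrete, and conditionally on each atom $x$ of $X$ the vector $Y$ has a density $h(\cdot\mid x)$. With $g$ denoting a density of $Y$, there are an atom $x_0$ of $X$ and a point $y_0$ with $\Pr(X=x_0)h(y_0\mid x_0)\ne\Pr(X=x_0)g(y_0)$, such that $h(\cdot\mid x_0)$ is continuous at $y_0$. -/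

import Mathlib

open Filter Topology MeasureTheory ProbabilityTheory
open scoped NNReal ENNReal

namespace RankTest

/-! ### The test statistic and the permutation test -/

/-- For a sample `x` and a norm `n`, the point `x k` is at most as far from `x i` as `x j` is. -/
def Near {p N : ℕ} (n : Seminorm ℝ (Fin p → ℝ)) (x : Fin N → Fin p → ℝ) (i j k : Fin N) : Prop :=
  n (x i - x k) ≤ n (x i - x j)

open Classical in
/-- The number of indices `k`, other than `i` and `j`, at which both `a` and `b` hold. -/
noncomputable def cellCount {N : ℕ} (i j : Fin N) (a b : Fin N → Prop) : ℕ :=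
  (Finset.univ.filter fun k => k ≠ i ∧ k ≠ j ∧ a k ∧ b k).card

section Statistic

variable {p q N : ℕ} (nX : Seminorm ℝ (Fin p → ℝ)) (nY : Seminorm ℝ (Fin q → ℝ))
  (x : Fin N → Fin p → ℝ) (y : Fin N → Fin q → ℝ) (i j : Fin N)

noncomputable def A11 : ℕ := cellCount i j (Near nX x i j) (Near nY y i j)

noncomputable def A12 : ℕ := cellCount i j (Near nX x i j) (fun k => ¬ Near nY y i j k)

noncomputable def A21 : ℕ := cellCount i j (fun k => ¬ Near nX x i j k) (Near nY y i j)

noncomputable def A22 : ℕ :=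
  cellCount i j (fun k => ¬ Near nX x i j k) (fun k => ¬ Near nY y i j k)

/-- Pearson's chi-square statistic of the `2 × 2` table of `i, j`; it is set to `0` if one of the
margins of the table vanishes. -/
noncomputable def S : ℝ :=
  let a11 : ℝ := A11 nX nY x y i j
  let a12 : ℝ := A12 nX nY x y i j
  let a21 : ℝ := A21 nX nY x y i j
  let a22 : ℝ := A22 nX nY x y i j
  if a11 + a12 = 0 ∨ a21 + a22 = 0 ∨ a11 + a21 = 0 ∨ a12 + a22 = 0 then 0
  else ((N : ℝ) - 2) * (a12 * a21 - a11 * a22) ^ 2 /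
    ((a11 + a12) * (a21 + a22) * (a11 + a21) * (a12 + a22))

/-- The test statistic: the sum of `S` over all ordered pairs of distinct indices. -/
noncomputable def T : ℝ :=
  ∑ i : Fin N, ∑ j ∈ Finset.univ.erase i, S nX nY x y i j

open Classical in
/-- The permutation p-value: the fraction of the permutations of the indices of the `y` sample for
which the statistic is at least as large as the observed one. -/
noncomputable def pValue : ℝ :=
  ((Finset.univ.filter fun σ : Equiv.Perm (Fin N) =>
    T nX nY x y ≤ T nX nY x (fun k => y (σ k))).card : ℝ) / (Nat.factorial N : ℝ)

end Statistic

/-! ### Discrete and continuous random vectors -/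

section Laws

variable {Ω : Type*} [MeasurableSpace Ω]

/-- A random vector with countable support. -/
def IsDiscrete {α : Type*} (P : Measure Ω) (Z : Ω → α) : Prop :=
  ∃ C : Set α, C.Countable ∧ ∀ᵐ ω ∂P, Z ω ∈ C

/-- `f` is a (version of the) density of `Z` under `P`, with respect to Lebesgue measure. -/
def IsDensity {β : Type*} [MeasureSpace β] (P : Measure Ω) (Z : Ω → β) (f : β → ℝ≥0) : Prop :=
  Measurable f ∧ P.map Z = volume.withDensity (fun z => (f z : ℝ≥0∞))

/-- For every atom `a` of `D`, `h a` is a (version of the) density of `Z` conditional on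
`D = a`. -/
def IsCondDensity {α β : Type*} [MeasureSpace β] (P : Measure Ω) (D : Ω → α) (Z : Ω → β)
    (h : α → β → ℝ≥0) : Prop :=
  ∀ a : α, P (D ⁻¹' {a}) ≠ 0 → IsDensity (ProbabilityTheory.cond P (D ⁻¹' {a})) Z (h a)

variable {p q : ℕ} (P : Measure Ω) (X : Ω → Fin p → ℝ) (Y : Ω → Fin q → ℝ)

/-- `X` and `Y` are continuous, and the joint density is continuous at a point of dependence. -/
def ContinuousCase : Prop :=
  ∃ (h : (Fin p → ℝ) × (Fin q → ℝ) → ℝ≥0) (f : (Fin p → ℝ) → ℝ≥0) (g : (Fin q → ℝ) → ℝ≥0)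
    (x₀ : Fin p → ℝ) (y₀ : Fin q → ℝ),
    IsDensity P (fun ω => (X ω, Y ω)) h ∧ IsDensity P X f ∧ IsDensity P Y g ∧
    h (x₀, y₀) ≠ f x₀ * g y₀ ∧
    ContinuousAt h (x₀, y₀)

/-- The coordinates of `X` in `u` and those of `Y` in `s` are discrete, at least one of `u`, `s` is
non-empty, the other coordinates are continuous, and both `X` and `Y` have continuous coordinates;
there is a point of dependence `(x₀, y₀)` whose discrete part is an isolated atom and at which the
joint density of the continuous coordinates conditional on that atom is continuous. -/
def MixedCase : Prop :=
  ∃ (u : Finset (Fin p)) (s : Finset (Fin q)),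
    (u.Nonempty ∨ s.Nonempty) ∧ uᶜ.Nonempty ∧ sᶜ.Nonempty ∧
    IsDiscrete P (fun ω => u.restrict (X ω)) ∧ IsDiscrete P (fun ω => s.restrict (Y ω)) ∧
    ∃ (h : (u → ℝ) × (s → ℝ) → (↥uᶜ → ℝ) × (↥sᶜ → ℝ) → ℝ≥0)
      (f : (u → ℝ) → (↥uᶜ → ℝ) → ℝ≥0) (g : (s → ℝ) → (↥sᶜ → ℝ) → ℝ≥0)
      (x₀ : Fin p → ℝ) (y₀ : Fin q → ℝ),
      IsCondDensity P (fun ω => (u.restrict (X ω), s.restrict (Y ω)))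
        (fun ω => (uᶜ.restrict (X ω), sᶜ.restrict (Y ω))) h ∧
      IsCondDensity P (fun ω => u.restrict (X ω)) (fun ω => uᶜ.restrict (X ω)) f ∧
      IsCondDensity P (fun ω => s.restrict (Y ω)) (fun ω => sᶜ.restrict (Y ω)) g ∧
      -- the point is a point of dependence
      P.real {ω | u.restrict (X ω) = u.restrict x₀ ∧ s.restrict (Y ω) = s.restrict y₀} *
          h (u.restrict x₀, s.restrict y₀) (uᶜ.restrict x₀, sᶜ.restrict y₀) ≠
        P.real {ω | u.restrict (X ω) = u.restrict x₀} * f (u.restrict x₀) (uᶜ.restrict x₀) *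
          (P.real {ω | s.restrict (Y ω) = s.restrict y₀} *
            g (s.restrict y₀) (sᶜ.restrict y₀)) ∧
      -- its discrete part is an atom, and the only atom in some ball around it
      P {ω | u.restrict (X ω) = u.restrict x₀ ∧ s.restrict (Y ω) = s.restrict y₀} ≠ 0 ∧
      (∃ ε > 0, ∀ (a : u → ℝ) (b : s → ℝ),
        (a, b) ∈ Metric.ball (u.restrict x₀, s.restrict y₀) ε →
        P {ω | u.restrict (X ω) = a ∧ s.restrict (Y ω) = b} ≠ 0 →
        (a, b) = (u.restrict x₀, s.restrict y₀)) ∧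
      ContinuousAt (h (u.restrict x₀, s.restrict y₀)) (uᶜ.restrict x₀, sᶜ.restrict y₀)

/-- `X` and `Y` are discrete. -/
def DiscreteCase : Prop :=
  IsDiscrete P X ∧ IsDiscrete P Y

/-- `X` is discrete and `Y` is continuous (given `X`), and there is a point of dependence
`(x₀, y₀)` at which the density of `Y` conditional on `X = x₀` is continuous. -/
def DiscreteContinuousCase : Prop :=
  IsDiscrete P X ∧
  ∃ (h : (Fin p → ℝ) → (Fin q → ℝ) → ℝ≥0) (g : (Fin q → ℝ) → ℝ≥0)
    (x₀ : Fin p → ℝ) (y₀ : Fin q → ℝ),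
    IsCondDensity P X Y h ∧ IsDensity P Y g ∧
    P {ω | X ω = x₀} ≠ 0 ∧
    P.real {ω | X ω = x₀} * h x₀ y₀ ≠ P.real {ω | X ω = x₀} * g y₀ ∧
    ContinuousAt (h x₀) y₀

end Laws

end RankTest

/-!
The permutation test is consistent because the statistic is of order `N ^ 3` under dependence,
while its mean over the permutations is of order `N ^ 2` whatever the sample.

*Permutation distribution.* Once the images of `i` and `j` are fixed, a random permutation shuffles
the columns of the table of `i, j` uniformly, so that Pearson's statistic has mean
at most `n / (n - 1)` with `n = N - 2` (`sum_perm_chiSq_le`). Markov's inequality gives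
`pValue ≤ 2 * N ^ 2 / T` (`pValue_le`).

*Size of the statistic.* Up to a factor, `S i j` is bounded below by `N⁻³` times the square of the
determinant of its table (`le_chiSq`). Summed over `i` and `j` this is a U-statistic with a bounded
kernel in six arguments (`le_T`), which obeys a weak law of large numbers
(`tendsto_measure_sum_injective`). Divided by `N ^ 6`, it tends to the mean of
`(μ (B × B') - μ (B × univ) * μ (univ × B')) ^ 2`, where `μ` is the law of `(X, Y)` and `B`, `B'` are
the balls whose centres are the components of a `μ`-random point and which have those of an
independent one on their boundaries (`integral_kernel`).

*Positivity of the limit.* In each of the four cases `μ` is absolutely continuous with respect to the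
product `ν` of its marginals (`map_prodMk_absolutelyContinuous_of_case`); for vectors with discrete
and continuous coordinates this is checked atom by atom. If the limit vanished, `μ` and `ν` would
agree on almost all of the products of balls above. At a Lebesgue point `z` of the density
`f = dμ/dν` with `f z > 0`, which exists almost everywhere by the Besicovitch covering theorem, a
small ball around `z` contains a product of this kind with at least a quarter of the `ν`-mass of the
ball, so `f z` is close to the ratio `1` of the two measures of that product. Hence `f ≤ 1` almost
everywhere and `μ = ν` (`eq_prod_of_measure_closedBall_eq`), against the dependence of `X` and `Y`.
Dependence is used only through `μ ≠ ν`: a pointwise inequality between densities says nothing by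
itself, as a density may be changed at a point.
-/

namespace RankTest

/-! ### The mean of the statistic over the permutations -/

/-- The second moment of the permutation statistic `∑ k, r k * c (τ k)`, for centred `r` and `c`. -/
lemma sum_perm_sum_mul_sq {κ : Type*} [Fintype κ] [DecidableEq κ] (r c : κ → ℝ)
    (hr : ∑ k, r k = 0) (hc : ∑ k, c k = 0) :
    ((Fintype.card κ : ℝ) - 1) * ∑ τ : Equiv.Perm κ, (∑ k, r k * c (τ k)) ^ 2 =
      (Fintype.card κ).factorial * ((∑ k, r k ^ 2) * ∑ k, c k ^ 2) := by
  classical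
  set n : ℝ := (Fintype.card κ : ℝ) with hn
  let G : κ → κ → ℝ := fun k l => ∑ τ : Equiv.Perm κ, c (τ k) * c (τ l)
  have hsymm : ∀ (π : Equiv.Perm κ) (k l : κ), G (π k) (π l) = G k l := fun π k l =>
    Fintype.sum_equiv (Equiv.mulRight π) _ _ fun τ => rfl
  have hdiag : ∀ k, n * G k k = (Fintype.card κ).factorial * ∑ k, c k ^ 2 := by
    intro k
    have h1 : ∀ l, G l l = G k k := fun l => by
      have := hsymm (Equiv.swap k l) k k
      rwa [Equiv.swap_apply_left] at this
    have h2 : ∑ l, G l l = n * G k k := by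
      simp [h1, hn]
    rw [← h2]
    simp only [G]
    rw [Finset.sum_comm]
    have h3 : ∀ τ : Equiv.Perm κ, ∑ l, c (τ l) * c (τ l) = ∑ l, c l ^ 2 := fun τ => by
      rw [Equiv.sum_comp τ (fun l => c l * c l)]
      simp [sq]
    simp [h3, Fintype.card_perm]
  have hrow : ∀ k, ∑ l, G k l = 0 := by
    intro k
    simp only [G]
    rw [Finset.sum_comm]
    refine Finset.sum_eq_zero fun τ _ => ?_
    rw [← Finset.mul_sum, Equiv.sum_comp τ c, hc, mul_zero]
  have hoff : ∀ k l, (n - 1) * G k l = (if k = l then n * G k k else 0) - G k k := by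
    intro k l
    by_cases hkl : k = l
    · subst hkl
      simp
      ring
    · have h1 : ∀ m ∈ Finset.univ.erase k, G k m = G k l := fun m hm => by
        have hmk : m ≠ k := Finset.ne_of_mem_erase hm
        have := hsymm (Equiv.swap l m) k l
        rwa [Equiv.swap_apply_left, Equiv.swap_apply_of_ne_of_ne hkl hmk.symm] at this
      have h2 := Finset.add_sum_erase Finset.univ (G k) (Finset.mem_univ k)
      rw [hrow, Finset.sum_congr rfl h1, Finset.sum_const, Finset.card_erase_of_mem
        (Finset.mem_univ k), Finset.card_univ, nsmul_eq_mul, Nat.cast_sub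
        (Fintype.card_pos_iff.2 ⟨k⟩), Nat.cast_one] at h2
      simp only [hkl, if_false]
      linarith
  have hexp : ∑ τ : Equiv.Perm κ, (∑ k, r k * c (τ k)) ^ 2 = ∑ k, ∑ l, r k * r l * G k l := by
    have h1 : ∀ τ : Equiv.Perm κ, (∑ k, r k * c (τ k)) ^ 2 =
        ∑ k, ∑ l, r k * r l * (c (τ k) * c (τ l)) := fun τ => by
      rw [sq, Finset.sum_mul_sum]
      exact Finset.sum_congr rfl fun k _ => Finset.sum_congr rfl fun l _ => by ring
    simp only [G, h1, Finset.mul_sum]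
    rw [Finset.sum_comm]
    exact Finset.sum_congr rfl fun k _ => Finset.sum_comm
  have hconst : ∀ k l, G k k = G l l := fun k l => by
    have := hsymm (Equiv.swap l k) l l
    rwa [Equiv.swap_apply_left] at this
  rw [hexp, Finset.mul_sum]
  calc ∑ k, (n - 1) * ∑ l, r k * r l * G k l
      = ∑ k, (n * G k k * r k ^ 2 - G k k * r k * ∑ l, r l) := by
        refine Finset.sum_congr rfl fun k _ => ?_
        have : ∀ l, (n - 1) * (r k * r l * G k l) =
            (if k = l then n * G k k * r k * r l else 0) - G k k * r k * r l := fun l => by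
          rw [show (n - 1) * (r k * r l * G k l) = r k * r l * ((n - 1) * G k l) by ring, hoff]
          split_ifs <;> ring
        rw [Finset.mul_sum, Finset.sum_congr rfl fun l _ => this l, Finset.sum_sub_distrib,
          Finset.sum_ite_eq, if_pos (Finset.mem_univ k), ← Finset.mul_sum]
        ring
    _ = _ := by
        simp only [hr, mul_zero, sub_zero, hdiag]
        rw [← Finset.mul_sum]
        ring

/-- Pearson's chi-square statistic of the `2 × 2` table of two `0`-`1` vectors `r`, `c` on an index
type `κ`, set to `0` if one of the margins of the table vanishes. -/
noncomputable def chiSq {κ : Type*} [Fintype κ] (r c : κ → ℝ) : ℝ :=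
  let n : ℝ := Fintype.card κ
  let R : ℝ := ∑ k, r k
  let C : ℝ := ∑ k, c k
  if R = 0 ∨ n - R = 0 ∨ C = 0 ∨ n - C = 0 then 0
  else n * (n * ∑ k, r k * c k - R * C) ^ 2 / (R * (n - R) * C * (n - C))

lemma sum_centred {κ : Type*} [Fintype κ] [Nonempty κ] (r : κ → ℝ) :
    ∑ k, (r k - (∑ l, r l) / Fintype.card κ) = 0 := by
  rw [Finset.sum_sub_distrib, Finset.sum_const, Finset.card_univ, nsmul_eq_mul]
  have : (Fintype.card κ : ℝ) ≠ 0 := by simp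
  field_simp
  ring

lemma sum_centred_mul {κ : Type*} [Fintype κ] [Nonempty κ] (r c : κ → ℝ) :
    Fintype.card κ * ∑ k, (r k - (∑ l, r l) / Fintype.card κ) *
      (c k - (∑ l, c l) / Fintype.card κ) =
    Fintype.card κ * ∑ k, r k * c k - (∑ k, r k) * ∑ k, c k := by
  set n : ℝ := (Fintype.card κ : ℝ) with hn
  have hn0 : n ≠ 0 := by simp [hn]
  have h : ∀ k, (r k - (∑ l, r l) / n) * (c k - (∑ l, c l) / n) =
      r k * c k - (∑ l, c l) / n * r k - (∑ l, r l) / n * c k + (∑ l, r l) / n * ((∑ l, c l) / n) :=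
    fun k => by ring
  simp only [h, Finset.sum_add_distrib, Finset.sum_sub_distrib, ← Finset.mul_sum,
    Finset.sum_const, Finset.card_univ, nsmul_eq_mul, ← hn]
  field_simp
  ring

/-- Under the permutation distribution the chi-square statistic has mean at most `n / (n - 1)`. -/
lemma sum_perm_chiSq_le {κ : Type*} [Fintype κ] [DecidableEq κ] [Nonempty κ] (r c : κ → ℝ)
    (hr : ∀ k, r k ^ 2 = r k) (hc : ∀ k, c k ^ 2 = c k) :
    ((Fintype.card κ : ℝ) - 1) * ∑ τ : Equiv.Perm κ, chiSq r (fun k => c (τ k)) ≤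
      (Fintype.card κ).factorial * Fintype.card κ := by
  have key := sum_perm_sum_mul_sq (fun k => r k - (∑ l, r l) / Fintype.card κ)
    (fun k => c k - (∑ l, c l) / Fintype.card κ) (sum_centred r) (sum_centred c)
  have hr2 := sum_centred_mul r r
  have hc2 := sum_centred_mul c c
  simp only [← sq, hr, hc] at hr2 hc2
  have hcomp : ∀ τ : Equiv.Perm κ, ∑ k, c (τ k) = ∑ k, c k := fun τ => Equiv.sum_comp τ c
  have hrc : ∀ τ : Equiv.Perm κ, Fintype.card κ * ∑ k, (r k - (∑ l, r l) / Fintype.card κ) *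
      (c (τ k) - (∑ l, c l) / Fintype.card κ) =
      Fintype.card κ * ∑ k, r k * c (τ k) - (∑ k, r k) * ∑ k, c k := fun τ => by
    have := sum_centred_mul r (fun k => c (τ k))
    rwa [hcomp] at this
  simp only [chiSq, hcomp]
  set n : ℝ := (Fintype.card κ : ℝ) with hn
  have hn0 : n ≠ 0 := by simp [hn]
  set R := ∑ k, r k
  set C := ∑ k, c k
  split_ifs with h
  · simp only [Finset.sum_const_zero, mul_zero]
    positivity
  · push Not at h
    obtain ⟨h1, h2, h3, h4⟩ := h
    apply le_of_eq
    simp only [← hrc]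
    rw [← Finset.sum_div, ← Finset.mul_sum]
    simp only [mul_pow]
    rw [← Finset.mul_sum, mul_div_assoc', div_eq_iff (by positivity)]
    calc _ = n * n ^ 2 * ((n - 1) * ∑ τ : Equiv.Perm κ,
          (∑ k, (r k - R / n) * (c (τ k) - C / n)) ^ 2) := by ring
      _ = _ := by
        rw [key]
        linear_combination (n * (Fintype.card κ).factorial : ℝ) * (n * ∑ k, (c k - C / n) ^ 2) * hr2
          + (n * (Fintype.card κ).factorial : ℝ) * (n * R - R ^ 2) * hc2

/-- The `0`-`1` valued indicator of a proposition. -/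
noncomputable def ind (a : Prop) : ℝ := by
  classical exact if a then 1 else 0

@[simp] lemma ind_sq (a : Prop) : ind a ^ 2 = ind a := by
  unfold ind; split_ifs <;> simp

@[simp] lemma ind_not (a : Prop) : ind (¬ a) = 1 - ind a := by
  by_cases h : a <;> simp [ind, h]

lemma cellCount_eq {N : ℕ} (i j : Fin N) (a b : Fin N → Prop) :
    (cellCount i j a b : ℝ) = ∑ k : {k // k ≠ i ∧ k ≠ j}, ind (a k) * ind (b k) := by
  classical
  rw [cellCount, ← Finset.sum_subtype (Finset.univ.filter fun k => k ≠ i ∧ k ≠ j) (by simp)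
    (fun k => ind (a k) * ind (b k)), Finset.card_filter, Finset.sum_filter, Nat.cast_sum]
  refine Finset.sum_congr rfl fun k _ => ?_
  by_cases h1 : k = i <;> by_cases h2 : k = j <;> by_cases h3 : a k <;> by_cases h4 : b k <;>
    simp [ind, h1, h2, h3, h4]

lemma card_ne_ne {N : ℕ} {i j : Fin N} (hij : i ≠ j) :
    Fintype.card {k // k ≠ i ∧ k ≠ j} = N - 2 := by
  classical
  rw [Fintype.card_subtype]
  have : (Finset.univ.filter fun k : Fin N => k ≠ i ∧ k ≠ j) = (Finset.univ.erase i).erase j := by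
    ext k; simp [and_comm]
  rw [this, Finset.card_erase_of_mem (by simp [hij.symm]), Finset.card_erase_of_mem (by simp),
    Finset.card_univ, Fintype.card_fin]
  omega

section

variable {p q N : ℕ} (nX : Seminorm ℝ (Fin p → ℝ)) (nY : Seminorm ℝ (Fin q → ℝ))
  (x : Fin N → Fin p → ℝ) (y : Fin N → Fin q → ℝ)

lemma S_eq_chiSq {i j : Fin N} (hij : i ≠ j) :
    S nX nY x y i j = chiSq (fun k : {k // k ≠ i ∧ k ≠ j} => ind (Near nX x i j k))
      (fun k => ind (Near nY y i j k)) := by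
  have h2 : 2 ≤ N := by
    have := i.2; have := j.2; have : (i : ℕ) ≠ j := fun h => hij (Fin.ext h)
    omega
  have hcard : (Fintype.card {k // k ≠ i ∧ k ≠ j} : ℝ) = N - 2 := by
    rw [card_ne_ne hij, Nat.cast_sub h2, Nat.cast_two]
  have hone : ∑ k : {k // k ≠ i ∧ k ≠ j}, (1 : ℝ) = N - 2 := by
    rw [← hcard]; simp
  set R := ∑ k : {k // k ≠ i ∧ k ≠ j}, ind (Near nX x i j k) with hR
  set C := ∑ k : {k // k ≠ i ∧ k ≠ j}, ind (Near nY y i j k) with hC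
  set s := ∑ k : {k // k ≠ i ∧ k ≠ j}, ind (Near nX x i j k) * ind (Near nY y i j k) with hs
  have h11 : (A11 nX nY x y i j : ℝ) = s := cellCount_eq _ _ _ _
  have h12 : (A12 nX nY x y i j : ℝ) = R - s := by
    rw [A12, cellCount_eq, hR, hs, ← Finset.sum_sub_distrib]
    exact Finset.sum_congr rfl fun k _ => by rw [ind_not]; ring
  have h21 : (A21 nX nY x y i j : ℝ) = C - s := by
    rw [A21, cellCount_eq, hC, hs, ← Finset.sum_sub_distrib]
    exact Finset.sum_congr rfl fun k _ => by rw [ind_not]; ring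
  have h22 : (A22 nX nY x y i j : ℝ) = N - 2 - R - C + s := by
    rw [A22, cellCount_eq, ← hone, hC, hR, hs, ← Finset.sum_sub_distrib, ← Finset.sum_sub_distrib,
      ← Finset.sum_add_distrib]
    exact Finset.sum_congr rfl fun k _ => by rw [ind_not, ind_not]; ring
  have e1 : s + (R - s) = R := by ring
  have e2 : C - s + (N - 2 - R - C + s) = N - 2 - R := by ring
  have e3 : s + (C - s) = C := by ring
  have e4 : R - s + (N - 2 - R - C + s) = N - 2 - C := by ring
  simp only [S, chiSq, hcard, h11, h12, h21, h22, e1, e2, e3, e4, ← hR, ← hC, ← hs]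
  split_ifs
  · rfl
  · congr 2
    ring

lemma S_nonneg (i j : Fin N) (hN : 2 ≤ N) : 0 ≤ S nX nY x y i j := by
  have : (0 : ℝ) ≤ N - 2 := by
    have : (2 : ℝ) ≤ N := by exact_mod_cast hN
    linarith
  simp only [S]
  split_ifs
  · exact le_rfl
  · positivity

/-- Conditioning on the images of `i` and `j`, the mean of `S i j` over the permutations is at most
`(N - 2) / (N - 3)`, hence at most `2`. -/
lemma sum_perm_S_le {i j : Fin N} (hij : i ≠ j) (hN : 4 ≤ N) :
    ∑ σ : Equiv.Perm (Fin N), S nX nY x (fun k => y (σ k)) i j ≤ 2 * N.factorial := by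
  classical
  -- averaging over the permutations `τ` that fix `i` and `j` does not change the sum over `σ`
  let κ := {k : Fin N // k ≠ i ∧ k ≠ j}
  have hcard : Fintype.card κ = N - 2 := card_ne_ne hij
  have : Nonempty κ := Fintype.card_pos_iff.1 (by omega)
  have hfix : ∀ τ : Equiv.Perm κ, Equiv.Perm.ofSubtype τ i = i ∧ Equiv.Perm.ofSubtype τ j = j :=
    fun τ => ⟨Equiv.Perm.ofSubtype_apply_of_not_mem τ (by simp),
      Equiv.Perm.ofSubtype_apply_of_not_mem τ (by simp)⟩
  have h1 : ∀ τ : Equiv.Perm κ,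
      ∑ σ : Equiv.Perm (Fin N), S nX nY x (fun k => y (σ k)) i j =
      ∑ σ : Equiv.Perm (Fin N), chiSq (fun k : κ => ind (Near nX x i j k))
        (fun k : κ => ind (Near nY (fun k => y (σ k)) i j (τ k))) := fun τ => by
    rw [← Equiv.sum_comp (Equiv.mulRight (Equiv.Perm.ofSubtype τ))]
    refine Finset.sum_congr rfl fun σ _ => ?_
    rw [S_eq_chiSq _ _ _ _ hij]
    congr 1
    funext k
    simp [Near, hfix, Equiv.Perm.ofSubtype_apply_coe]
  have h2 := Finset.sum_congr rfl fun (τ : Equiv.Perm κ) (_ : τ ∈ Finset.univ) => h1 τ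
  rw [Finset.sum_const, Finset.sum_comm, Finset.card_univ, Fintype.card_perm, nsmul_eq_mul] at h2
  have h3 : ∀ σ : Equiv.Perm (Fin N), ((Fintype.card κ : ℝ) - 1) *
      ∑ τ : Equiv.Perm κ, chiSq (fun k : κ => ind (Near nX x i j k))
        (fun k : κ => ind (Near nY (fun k => y (σ k)) i j (τ k))) ≤
      (Fintype.card κ).factorial * Fintype.card κ := fun σ =>
    sum_perm_chiSq_le (fun k : κ => ind (Near nX x i j k))
      (fun k : κ => ind (Near nY (fun k => y (σ k)) i j k)) (by simp) (by simp)
  have h4 := Finset.sum_le_sum fun (σ : Equiv.Perm (Fin N)) (_ : σ ∈ Finset.univ) => h3 σ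
  rw [← Finset.mul_sum, ← h2, Finset.sum_const, Finset.card_univ, Fintype.card_perm,
    Fintype.card_fin, nsmul_eq_mul] at h4
  have hc : (2 : ℝ) ≤ Fintype.card κ := by
    rw [hcard]; exact_mod_cast (by omega : 2 ≤ N - 2)
  have hf : (0 : ℝ) < (Fintype.card κ).factorial := by positivity
  have h5 : ((Fintype.card κ : ℝ) - 1) *
      ∑ σ : Equiv.Perm (Fin N), S nX nY x (fun k => y (σ k)) i j ≤
      N.factorial * Fintype.card κ := by
    refine le_of_mul_le_mul_left ?_ hf
    linarith
  have h6 : (Fintype.card κ : ℝ) * N.factorial ≤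
      ((Fintype.card κ : ℝ) - 1) * (2 * N.factorial) := by
    have : (0 : ℝ) ≤ N.factorial := by positivity
    nlinarith
  exact le_of_mul_le_mul_left (by linarith) (by linarith : (0 : ℝ) < (Fintype.card κ : ℝ) - 1)

lemma T_nonneg (hN : 2 ≤ N) : 0 ≤ T nX nY x y :=
  Finset.sum_nonneg fun i _ => Finset.sum_nonneg fun j _ => S_nonneg nX nY x y i j hN

lemma sum_perm_T_le (hN : 4 ≤ N) :
    ∑ σ : Equiv.Perm (Fin N), T nX nY x (fun k => y (σ k)) ≤ 2 * N ^ 2 * N.factorial := by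
  simp only [T]
  rw [Finset.sum_comm]
  calc _ ≤ ∑ i : Fin N, ∑ j : Fin N, (2 * N.factorial : ℝ) := by
        refine Finset.sum_le_sum fun i _ => ?_
        rw [Finset.sum_comm]
        refine (Finset.sum_le_sum fun j hj => sum_perm_S_le nX nY x y
          (Finset.ne_of_mem_erase hj).symm hN).trans ?_
        exact Finset.sum_le_sum_of_subset_of_nonneg (Finset.erase_subset _ _)
          fun _ _ _ => by positivity
    _ = _ := by simp; ring

/-- Markov's inequality for the permutation distribution: the p-value is small as soon as the
statistic is large compared with `N ^ 2`. -/
lemma pValue_le (hN : 4 ≤ N) {α : ℝ} (hα : 0 < α) (hT : 2 * (N : ℝ) ^ 2 / α ≤ T nX nY x y) :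
    pValue nX nY x y ≤ α := by
  classical
  have hN0 : (0 : ℝ) < N := by exact_mod_cast (by omega : 0 < N)
  have hTpos : 0 < T nX nY x y := lt_of_lt_of_le (by positivity) hT
  have hf : (0 : ℝ) < N.factorial := by positivity
  rw [pValue, div_le_iff₀ hf]
  have h1 := sum_perm_T_le nX nY x y hN
  have h2 : ((Finset.univ.filter fun σ : Equiv.Perm (Fin N) =>
      T nX nY x y ≤ T nX nY x (fun k => y (σ k))).card : ℝ) * T nX nY x y ≤
      ∑ σ : Equiv.Perm (Fin N), T nX nY x (fun k => y (σ k)) := by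
    rw [← nsmul_eq_mul]
    refine (Finset.card_nsmul_le_sum _ _ _ fun σ hσ => (Finset.mem_filter.1 hσ).2).trans ?_
    exact Finset.sum_le_sum_of_subset_of_nonneg (Finset.filter_subset _ _)
      fun σ _ _ => T_nonneg nX nY _ _ (by omega)
  rw [div_le_iff₀ hα] at hT
  have h3 := h2.trans h1
  refine le_of_mul_le_mul_right (h3.trans ?_) hTpos
  nlinarith

end

/-! ### Independence from the measures of products of balls -/

lemma measurable_measure_closedBall {E : Type*} [PseudoMetricSpace E] [MeasurableSpace E]
    [BorelSpace E] (μ : Measure E) (x : E) :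
    Measurable fun x' => μ (Metric.closedBall x (dist x' x)) := by
  have h : Monotone fun r : ℝ => μ (Metric.closedBall x r) :=
    fun r s hrs => measure_mono (Metric.closedBall_subset_closedBall hrs)
  exact h.measurable.comp (by fun_prop)

/-- The distribution of the `μ`-measure of the ball around `x` with a `μ`-random point on its
boundary lies below the uniform distribution. -/
lemma measure_measure_closedBall_lt_le {E : Type*} [MetricSpace E] [MeasurableSpace E]
    [BorelSpace E] (μ : Measure E) [IsFiniteMeasure μ] [μ.InnerRegularCompactLTTop] (x : E)
    (u : ℝ≥0∞) : μ {x' | μ (Metric.closedBall x (dist x' x)) < u} ≤ u := by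
  have hW : MeasurableSet {x' | μ (Metric.closedBall x (dist x' x)) < u} :=
    measurableSet_lt (measurable_measure_closedBall μ x) measurable_const
  rw [hW.measure_eq_iSup_isCompact_of_ne_top (measure_ne_top _ _)]
  refine iSup₂_le fun K hK => iSup_le fun hKc => ?_
  rcases K.eq_empty_or_nonempty with rfl | hne
  · simp
  -- a point of `K` farthest from `x` gives a ball which contains `K`
  obtain ⟨x', hx', hmax⟩ := hKc.exists_isMaxOn hne
    (f := fun x' => dist x' x) (by fun_prop)
  exact (measure_mono fun w hw => hmax hw).trans (hK hx').le

/-- At least half of the mass of a ball around `x` sits at points whose distance to `x` is the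
radius of a ball with at least half of that mass. -/
lemma half_measureReal_closedBall_le {E : Type*} [MetricSpace E] [MeasurableSpace E]
    [BorelSpace E] (μ : Measure E) [IsFiniteMeasure μ] [μ.InnerRegularCompactLTTop] (x : E)
    (r : ℝ) :
    μ.real (Metric.closedBall x r) / 2 ≤ μ.real (Metric.closedBall x r ∩
      {x' | μ (Metric.closedBall x r) / 2 ≤ μ (Metric.closedBall x (dist x' x))}) := by
  set B := Metric.closedBall x r
  have h1 : μ.real B ≤ μ.real (B ∩ {x' | μ B / 2 ≤ μ (Metric.closedBall x (dist x' x))}) +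
      μ.real {x' | μ (Metric.closedBall x (dist x' x)) < μ B / 2} := by
    refine (measureReal_mono fun w hw => ?_).trans (measureReal_union_le _ _)
    rcases lt_or_ge (μ (Metric.closedBall x (dist w x))) (μ B / 2) with h | h
    · exact Or.inr h
    · exact Or.inl ⟨hw, h⟩
  have h2 : μ.real {x' | μ (Metric.closedBall x (dist x' x)) < μ B / 2} ≤ μ.real B / 2 := by
    have := ENNReal.toReal_mono (by simp [ENNReal.div_eq_top])
      (measure_measure_closedBall_lt_le μ x (μ B / 2))
    simpa [Measure.real] using this
  linarith

/-- If at a Lebesgue point `z` of the density `f` of `μ` with respect to `μ₁.prod μ₂`, with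
`f z > 0`, almost all of the points `z'` with `f z' ≠ 0` span a product of balls around `z` which
`μ` and `μ₁.prod μ₂` charge equally, then `f z = 1`. -/
lemma density_eq_one_of_measure_closedBall_eq {E F : Type*}
    [MetricSpace E] [MeasurableSpace E] [BorelSpace E] [SecondCountableTopology E]
    [MetricSpace F] [MeasurableSpace F] [BorelSpace F] [SecondCountableTopology F]
    (μ₁ : Measure E) [IsFiniteMeasure μ₁] [μ₁.InnerRegularCompactLTTop]
    (μ₂ : Measure F) [IsFiniteMeasure μ₂] [μ₂.InnerRegularCompactLTTop]
    (μ : Measure (E × F)) [IsFiniteMeasure μ] (f : E × F → ℝ)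
    (hf : Integrable f (μ₁.prod μ₂))
    (hμ : ∀ A, MeasurableSet A → μ.real A = ∫ w in A, f w ∂μ₁.prod μ₂) (z : E × F) (hz : 0 < f z)
    (hleb : Tendsto (fun r => ⨍ w in Metric.closedBall z r, ‖f w - f z‖ ∂μ₁.prod μ₂)
      (𝓝[>] 0) (𝓝 0))
    (hpos : ∀ᶠ r in 𝓝[>] 0, 0 < (μ₁.prod μ₂) (Metric.closedBall z r))
    (heq : ∀ᵐ z' ∂μ₁.prod μ₂, f z' ≠ 0 →
      μ (Metric.closedBall z.1 (dist z'.1 z.1) ×ˢ Metric.closedBall z.2 (dist z'.2 z.2)) =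
      μ₁ (Metric.closedBall z.1 (dist z'.1 z.1)) * μ₂ (Metric.closedBall z.2 (dist z'.2 z.2))) :
    f z = 1 := by
  set ν := μ₁.prod μ₂ with hν
  set c := f z with hc
  have key : ∀ η : ℝ, 0 < η → η < c / 4 → |1 - c| ≤ 4 * η := by
    intro η hη hηc
    obtain ⟨r, hr1, hr2, hr3⟩ := ((hleb.eventually (gt_mem_nhds hη)).and
      (hpos.and self_mem_nhdsWithin)).exists
    set B := Metric.closedBall z r with hB
    have hBprod : B = Metric.closedBall z.1 r ×ˢ Metric.closedBall z.2 r :=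
      (closedBall_prod_same z.1 z.2 r).symm
    have hνB : 0 < ν.real B := ENNReal.toReal_pos hr2.ne' (measure_ne_top _ _)
    have hint : IntegrableOn (fun w => ‖f w - c‖) B ν :=
      (hf.sub (integrable_const c)).norm.integrableOn
    have hη' : ∫ w in B, ‖f w - c‖ ∂ν ≤ η * ν.real B := by
      rw [setAverage_eq, smul_eq_mul, inv_mul_lt_iff₀ hνB] at hr1
      linarith
    -- points of `A₁ ×ˢ A₂` span products of balls with at least a quarter of the mass of `B`
    set A₁ := Metric.closedBall z.1 r ∩ {x' | μ₁ (Metric.closedBall z.1 r) / 2 ≤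
      μ₁ (Metric.closedBall z.1 (dist x' z.1))} with hA₁
    set A₂ := Metric.closedBall z.2 r ∩ {x' | μ₂ (Metric.closedBall z.2 r) / 2 ≤
      μ₂ (Metric.closedBall z.2 (dist x' z.2))} with hA₂
    have hA : MeasurableSet (A₁ ×ˢ A₂) :=
      (Metric.isClosed_closedBall.measurableSet.inter
        (measurableSet_le measurable_const (measurable_measure_closedBall μ₁ z.1))).prod
      (Metric.isClosed_closedBall.measurableSet.inter
        (measurableSet_le measurable_const (measurable_measure_closedBall μ₂ z.2)))
    have hAB : A₁ ×ˢ A₂ ⊆ B := by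
      rw [hBprod]
      exact Set.prod_mono Set.inter_subset_left Set.inter_subset_left
    have hνBprod : ν.real B = μ₁.real (Metric.closedBall z.1 r) *
        μ₂.real (Metric.closedBall z.2 r) := by
      rw [hBprod, hν, measureReal_prod_prod]
    have hνA : ν.real B / 4 ≤ ν.real (A₁ ×ˢ A₂) := by
      rw [hνBprod, hν, measureReal_prod_prod]
      have h1 := half_measureReal_closedBall_le μ₁ z.1 r
      have h2 := half_measureReal_closedBall_le μ₂ z.2 r
      have := mul_le_mul h1 h2 (by positivity) (by positivity)
      linarith
    obtain ⟨z', hz'A, hz'⟩ : ∃ z' ∈ A₁ ×ˢ A₂,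
        μ (Metric.closedBall z.1 (dist z'.1 z.1) ×ˢ Metric.closedBall z.2 (dist z'.2 z.2)) =
        μ₁ (Metric.closedBall z.1 (dist z'.1 z.1)) *
          μ₂ (Metric.closedBall z.2 (dist z'.2 z.2)) := by
      by_contra! hcon
      have h0 : ∀ᵐ w ∂ν, w ∈ A₁ ×ˢ A₂ → ‖f w - c‖ = c := by
        filter_upwards [heq] with w hw hwA
        have : f w = 0 := by
          by_contra h
          exact hcon w hwA (hw h)
        rw [this, zero_sub, norm_neg, Real.norm_eq_abs, abs_of_pos hz]
      have h1 : ∫ w in A₁ ×ˢ A₂, ‖f w - c‖ ∂ν ≤ ∫ w in B, ‖f w - c‖ ∂ν :=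
        setIntegral_mono_set hint (Eventually.of_forall fun _ => norm_nonneg _)
          hAB.eventuallyLE
      rw [setIntegral_congr_ae hA h0, setIntegral_const, smul_eq_mul] at h1
      nlinarith
    set B' := Metric.closedBall z.1 (dist z'.1 z.1) ×ˢ Metric.closedBall z.2 (dist z'.2 z.2)
      with hB'
    have hB'B : B' ⊆ B := by
      rw [hBprod]
      exact Set.prod_mono (Metric.closedBall_subset_closedBall hz'A.1.1)
        (Metric.closedBall_subset_closedBall hz'A.2.1)
    have hB'm : MeasurableSet B' :=
      Metric.isClosed_closedBall.measurableSet.prod Metric.isClosed_closedBall.measurableSet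
    have hνB' : ν.real B / 4 ≤ ν.real B' := by
      rw [hνBprod, hν, hB', measureReal_prod_prod]
      have h1 := ENNReal.toReal_mono (measure_ne_top _ _) hz'A.1.2
      have h2 := ENNReal.toReal_mono (measure_ne_top _ _) hz'A.2.2
      simp only [ENNReal.toReal_div, ENNReal.toReal_ofNat, ← measureReal_def] at h1 h2
      have := mul_le_mul h1 h2 (by positivity) (by positivity)
      linarith
    have hμB' : μ.real B' = ν.real B' := by
      rw [measureReal_def, hz', ← Measure.prod_prod, measureReal_def]
    have h2 : |(1 - c) * ν.real B'| ≤ η * ν.real B := by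
      calc |(1 - c) * ν.real B'| = ‖∫ w in B', (f w - c) ∂ν‖ := by
            rw [integral_sub hf.integrableOn (integrable_const c).integrableOn, ← hμ B' hB'm, hμB',
              setIntegral_const, smul_eq_mul, Real.norm_eq_abs]
            congr 1; ring
        _ ≤ ∫ w in B', ‖f w - c‖ ∂ν := norm_integral_le_integral_norm _
        _ ≤ ∫ w in B, ‖f w - c‖ ∂ν :=
            setIntegral_mono_set hint (Eventually.of_forall fun _ => norm_nonneg _)
              hB'B.eventuallyLE
        _ ≤ _ := hη'
    rw [abs_mul, abs_of_nonneg (measureReal_nonneg)] at h2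
    have h3 : 0 < ν.real B' := by linarith
    refine le_of_mul_le_mul_right (h2.trans ?_) h3
    nlinarith
  have hzero : |1 - c| ≤ 0 := by
    refine le_of_forall_pos_le_add fun ε hε => ?_
    have h := key (min (ε / 4) (c / 8)) (by positivity)
      ((min_le_right _ _).trans_lt (by linarith))
    have := min_le_left (ε / 4) (c / 8)
    linarith
  have := abs_nonpos_iff.1 hzero
  linarith

/-- A probability measure that is absolutely continuous with respect to the product of its marginals
is equal to that product if the two agree on almost every product of balls `B × B'`, where a random
point is the centre and an independent one lies on both boundaries. -/
theorem eq_prod_of_measure_closedBall_eq {E F : Type*}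
    [NormedAddCommGroup E] [NormedSpace ℝ E] [FiniteDimensional ℝ E] [MeasurableSpace E]
    [BorelSpace E] [NormedAddCommGroup F] [NormedSpace ℝ F] [FiniteDimensional ℝ F]
    [MeasurableSpace F] [BorelSpace F] (μ : Measure (E × F)) [IsProbabilityMeasure μ]
    (hac : μ ≪ μ.fst.prod μ.snd)
    (heq : ∀ᵐ z ∂μ, ∀ᵐ z' ∂μ,
      μ (Metric.closedBall z.1 (dist z'.1 z.1) ×ˢ Metric.closedBall z.2 (dist z'.2 z.2)) =
      μ.fst (Metric.closedBall z.1 (dist z'.1 z.1)) *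
        μ.snd (Metric.closedBall z.2 (dist z'.2 z.2))) :
    μ = μ.fst.prod μ.snd := by
  have : ProperSpace E := FiniteDimensional.proper ℝ E
  have : ProperSpace F := FiniteDimensional.proper ℝ F
  set ν := μ.fst.prod μ.snd with hν
  set ρ := μ.rnDeriv ν with hρ
  have hρm : Measurable ρ := Measure.measurable_rnDeriv _ _
  have hμρ : ν.withDensity ρ = μ := Measure.withDensity_rnDeriv_eq _ _ hac
  set f : E × F → ℝ := fun z => (ρ z).toReal with hf
  have hfi : Integrable f ν := Measure.integrable_toReal_rnDeriv
  have hlt : ∀ᵐ z ∂ν, ρ z < ∞ := Measure.rnDeriv_lt_top _ _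
  have hset : ∀ A, MeasurableSet A → μ.real A = ∫ w in A, f w ∂ν := fun A hA =>
    (Measure.setIntegral_toReal_rnDeriv hac A).symm
  have hae : ∀ {Q : E × F → Prop}, (∀ᵐ z ∂μ, Q z) → ∀ᵐ z ∂ν, f z ≠ 0 → Q z := fun {Q} h => by
    rw [← hμρ, ae_withDensity_iff hρm] at h
    filter_upwards [h] with z hz hfz
    exact hz fun h0 => hfz (by simp [hf, h0])
  have hone : ∀ᵐ z ∂ν, ρ z ≤ 1 := by
    filter_upwards [(Besicovitch.vitaliFamily ν).ae_tendsto_average_norm_sub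
      hfi.locallyIntegrable, (Besicovitch.vitaliFamily ν).ae_eventually_measure_pos, hlt,
      hae heq] with z h1 h2 h3 h4
    rcases eq_or_ne (f z) 0 with h0 | h0
    · have : ρ z = 0 := by
        simpa [hf, ENNReal.toReal_eq_zero_iff, h3.ne] using h0
      simp [this]
    · have := density_eq_one_of_measure_closedBall_eq μ.fst μ.snd μ f hfi hset z
        (lt_of_le_of_ne ENNReal.toReal_nonneg h0.symm)
        (h1.comp (Besicovitch.tendsto_filterAt ν z))
        ((Besicovitch.tendsto_filterAt ν z).eventually h2) (hae (h4 h0))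
      rw [← ENNReal.ofReal_toReal h3.ne, show (ρ z).toReal = 1 from this, ENNReal.ofReal_one]
  refine Measure.eq_of_le_of_isProbabilityMeasure ?_
  calc μ = ν.withDensity ρ := hμρ.symm
    _ ≤ ν.withDensity 1 := withDensity_mono hone
    _ = ν := withDensity_one

/-! ### Domination of the joint law by the product of the marginal laws -/

lemma exists_restrict_absolutelyContinuous {α : Type*} [MeasurableSpace α] {μ τ : Measure α}
    [IsFiniteMeasure μ] [SigmaFinite τ] (h : μ ≪ τ) :
    ∃ A, MeasurableSet A ∧ μ Aᶜ = 0 ∧ τ.restrict A ≪ μ := by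
  have hm : Measurable (μ.rnDeriv τ) := Measure.measurable_rnDeriv _ _
  have hd : τ.withDensity (μ.rnDeriv τ) = μ := Measure.withDensity_rnDeriv_eq _ _ h
  set f := μ.rnDeriv τ
  have hA : MeasurableSet {x | f x ≠ 0} := (hm (measurableSet_singleton 0)).compl
  refine ⟨{x | f x ≠ 0}, hA, ?_, ?_⟩
  · calc μ {x | f x ≠ 0}ᶜ = ∫⁻ x in {x | f x ≠ 0}ᶜ, f x ∂τ := by
          rw [← withDensity_apply _ hA.compl, hd]
      _ = ∫⁻ x in {x | f x ≠ 0}ᶜ, 0 ∂τ :=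
          setLIntegral_congr_fun hA.compl fun x hx => by simpa using hx
      _ = 0 := lintegral_zero
  · have h0 : ∀ᵐ x ∂τ.restrict {x | f x ≠ 0}, f x ≠ 0 := ae_restrict_mem hA
    refine (withDensity_absolutelyContinuous' hm.aemeasurable h0).trans ?_
    rw [← restrict_withDensity hA, hd]
    exact Measure.restrict_le_self.absolutelyContinuous

/-- A measure which is absolutely continuous with respect to some product measure is so with respect
to the product of its own marginals. -/
lemma absolutelyContinuous_fst_prod_snd {α β : Type*} [MeasurableSpace α] [MeasurableSpace β]
    {μ : Measure (α × β)} [IsFiniteMeasure μ] {τ₁ : Measure α} {τ₂ : Measure β} [SigmaFinite τ₁]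
    [SigmaFinite τ₂] (h : μ ≪ τ₁.prod τ₂) : μ ≪ μ.fst.prod μ.snd := by
  have h₁ : μ.fst ≪ τ₁ := (h.map measurable_fst).trans Measure.quasiMeasurePreserving_fst.2
  have h₂ : μ.snd ≪ τ₂ := (h.map measurable_snd).trans Measure.quasiMeasurePreserving_snd.2
  obtain ⟨A, hA, hA0, hAτ⟩ := exists_restrict_absolutelyContinuous h₁
  obtain ⟨B, hB, hB0, hBτ⟩ := exists_restrict_absolutelyContinuous h₂
  rw [Measure.fst_apply hA.compl] at hA0
  rw [Measure.snd_apply hB.compl] at hB0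
  have hμ : μ.restrict (A ×ˢ B) = μ := by
    refine Measure.restrict_eq_self_of_ae_mem ?_
    refine measure_mono_null (fun w hw => ?_) (measure_union_null hA0 hB0)
    by_cases h : w.1 ∈ A
    · exact Or.inr fun hB => hw ⟨h, hB⟩
    · exact Or.inl h
  rw [← hμ]
  refine (h.restrict _).trans ?_
  rw [← Measure.prod_restrict, hμ]
  exact hAτ.prod hBτ

section

variable {Ω : Type*} [MeasurableSpace Ω] {P : Measure Ω}

lemma map_prodMk_absolutelyContinuous {α β : Type*} [MeasurableSpace α] [MeasurableSpace β]
    {X : Ω → α} {Y : Ω → β} [IsFiniteMeasure P] (hX : Measurable X) (hY : Measurable Y)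
    {τ₁ : Measure α} {τ₂ : Measure β} [SigmaFinite τ₁] [SigmaFinite τ₂]
    (h : P.map (fun ω => (X ω, Y ω)) ≪ τ₁.prod τ₂) :
    P.map (fun ω => (X ω, Y ω)) ≪ (P.map X).prod (P.map Y) := by
  have := Measure.isFiniteMeasure_map P (fun ω => (X ω, Y ω))
  have := absolutelyContinuous_fst_prod_snd h
  rwa [Measure.fst_map_prodMk hY, Measure.snd_map_prodMk hX] at this

lemma IsDensity.absolutelyContinuous {β : Type*} [MeasureSpace β] {Z : Ω → β} {f : β → ℝ≥0}
    (h : IsDensity P Z f) : P.map Z ≪ volume := by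
  rw [h.2]
  exact withDensity_absolutelyContinuous _ _

/-- If `X` is discrete, the joint law of `X` and any `Y` is dominated by the product of the laws. -/
lemma IsDiscrete.map_prodMk_absolutelyContinuous {α β : Type*} [MeasurableSpace α]
    [MeasurableSingletonClass α] [MeasurableSpace β] {X : Ω → α} {Y : Ω → β}
    [IsFiniteMeasure P] (hX : Measurable X) (hY : Measurable Y) (hd : IsDiscrete P X) :
    P.map (fun ω => (X ω, Y ω)) ≪ (P.map X).prod (P.map Y) := by
  obtain ⟨C, hC, hXC⟩ := hd
  refine Measure.AbsolutelyContinuous.mk fun s hs h0 => ?_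
  rw [Measure.measure_prod_null hs] at h0
  rw [Measure.map_apply (hX.prodMk hY) hs]
  have hatom : ∀ a ∈ C, P ((fun ω => (X ω, Y ω)) ⁻¹' s ∩ X ⁻¹' {a}) = 0 := by
    intro a _
    by_cases ha : P (X ⁻¹' {a}) = 0
    · exact measure_mono_null Set.inter_subset_right ha
    · have h1 : (P.map Y) (Prod.mk a ⁻¹' s) = 0 := by
        by_contra hne
        refine ha ?_
        rw [← Measure.map_apply hX (measurableSet_singleton a)]
        refine measure_mono_null (fun w hw => ?_) (ae_iff.1 h0)
        rw [Set.mem_singleton_iff.1 hw]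
        exact hne
      rw [Measure.map_apply hY (measurable_prodMk_left hs)] at h1
      refine measure_mono_null ?_ h1
      rintro ω ⟨h2, h3⟩
      rw [Set.mem_preimage, Set.mem_singleton_iff] at h3
      simpa [← h3] using h2
  refine measure_mono_null ?_ (measure_union_null hXC ((measure_biUnion_null_iff hC).2 hatom))
  intro ω hω
  by_cases h : X ω ∈ C
  · exact Or.inr (Set.mem_biUnion h ⟨hω, rfl⟩)
  · exact Or.inl h

/-- It suffices to prove that the joint law of `X` and `Y` is dominated by the product of the laws
conditionally on the atoms of a discrete variable `D`. -/
lemma map_prodMk_absolutelyContinuous_of_cond {α β δ : Type*} [MeasurableSpace α]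
    [MeasurableSpace β] [MeasurableSpace δ] [MeasurableSingletonClass δ] {X : Ω → α} {Y : Ω → β}
    {D : Ω → δ} [IsFiniteMeasure P] (hX : Measurable X) (hY : Measurable Y) (hD : Measurable D)
    (hd : IsDiscrete P D)
    (h : ∀ d, P (D ⁻¹' {d}) ≠ 0 → (P[|D ⁻¹' {d}]).map (fun ω => (X ω, Y ω)) ≪
      ((P[|D ⁻¹' {d}]).map X).prod ((P[|D ⁻¹' {d}]).map Y)) :
    P.map (fun ω => (X ω, Y ω)) ≪ (P.map X).prod (P.map Y) := by
  obtain ⟨C, hC, hDC⟩ := hd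
  refine Measure.AbsolutelyContinuous.mk fun s hs h0 => ?_
  rw [Measure.map_apply (hX.prodMk hY) hs]
  have hatom : ∀ d ∈ C, P (D ⁻¹' {d} ∩ (fun ω => (X ω, Y ω)) ⁻¹' s) = 0 := by
    intro d _
    by_cases hd : P (D ⁻¹' {d}) = 0
    · exact measure_mono_null Set.inter_subset_left hd
    · have hac : P[|D ⁻¹' {d}] ≪ P := cond_absolutelyContinuous
      have h1 := ((h d hd).trans ((hac.map hX).prod (hac.map hY))) h0
      rw [Measure.map_apply (hX.prodMk hY) hs,
        cond_apply (hD (measurableSet_singleton d))] at h1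
      rcases mul_eq_zero.1 h1 with h2 | h2
      · simp at h2
      · exact h2
  refine measure_mono_null ?_ (measure_union_null hDC ((measure_biUnion_null_iff hC).2 hatom))
  intro ω hω
  by_cases h : D ω ∈ C
  · exact Or.inr (Set.mem_biUnion h ⟨rfl, hω⟩)
  · exact Or.inl h

variable [IsProbabilityMeasure P] {p q : ℕ} {X : Ω → Fin p → ℝ} {Y : Ω → Fin q → ℝ}

/-- The vector whose coordinates in `u` are given by `a` and whose other coordinates are given by
`w`. -/
def glue {ι : Type*} [Fintype ι] [DecidableEq ι] (u : Finset ι) (a : u → ℝ) (w : ↥uᶜ → ℝ) : ι → ℝ :=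
  fun k => if h : k ∈ u then a ⟨k, h⟩ else w ⟨k, Finset.mem_compl.2 h⟩

lemma measurable_glue {ι : Type*} [Fintype ι] [DecidableEq ι] (u : Finset ι) (a : u → ℝ) :
    Measurable (glue u a) := by
  refine measurable_pi_lambda _ fun k => ?_
  by_cases h : k ∈ u
  · simp only [glue, h, dite_true]
    exact measurable_const
  · simp only [glue, h, dite_false]
    exact measurable_pi_apply _

lemma glue_restrict {ι : Type*} [Fintype ι] [DecidableEq ι] (u : Finset ι) (x : ι → ℝ) :
    glue u (u.restrict x) (uᶜ.restrict x) = x := by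
  funext k
  by_cases h : k ∈ u <;> simp [glue, h]

lemma MixedCase.absolutelyContinuous (hX : Measurable X) (hY : Measurable Y)
    (h : MixedCase P X Y) : P.map (fun ω => (X ω, Y ω)) ≪ (P.map X).prod (P.map Y) := by
  obtain ⟨u, s, -, -, -, ⟨CX, hCX, hXC⟩, ⟨CY, hCY, hYC⟩, k, -, -, -, -, hk, -⟩ := h
  have hXu : Measurable fun ω => u.restrict (X ω) := (Finset.measurable_restrict u).comp hX
  have hYs : Measurable fun ω => s.restrict (Y ω) := (Finset.measurable_restrict s).comp hY
  have hXv : Measurable fun ω => uᶜ.restrict (X ω) := (Finset.measurable_restrict uᶜ).comp hX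
  have hYt : Measurable fun ω => sᶜ.restrict (Y ω) := (Finset.measurable_restrict sᶜ).comp hY
  have hD := hXu.prodMk hYs
  refine map_prodMk_absolutelyContinuous_of_cond hX hY hD
    ⟨CX ×ˢ CY, hCX.prod hCY, by filter_upwards [hXC, hYC] with ω h1 h2 using ⟨h1, h2⟩⟩ ?_
  rintro ⟨a, b⟩ hab
  have hdens := hk (a, b) hab
  have hmem : ∀ᵐ ω ∂P[|(fun ω => (u.restrict (X ω), s.restrict (Y ω))) ⁻¹' {(a, b)}],
      ω ∈ (fun ω => (u.restrict (X ω), s.restrict (Y ω))) ⁻¹' {(a, b)} :=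
    ae_cond_mem (hD (measurableSet_singleton _))
  have := cond_isProbabilityMeasure hab
  set Pd := P[|(fun ω => (u.restrict (X ω), s.restrict (Y ω))) ⁻¹' {(a, b)}]
  have hac := hdens.absolutelyContinuous
  rw [Measure.volume_eq_prod] at hac
  -- on the atom, `X` and `Y` are functions of their continuous coordinates
  have h1 := (map_prodMk_absolutelyContinuous hXv hYt hac).map
    ((measurable_glue u a).prodMap (measurable_glue s b))
  have hXg : (fun ω => glue u a (uᶜ.restrict (X ω))) =ᵐ[Pd] X := by
    filter_upwards [hmem] with ω hω
    have h := (Prod.ext_iff.1 hω).1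
    dsimp only at h
    rw [← h]
    exact glue_restrict u (X ω)
  have hYg : (fun ω => glue s b (sᶜ.restrict (Y ω))) =ᵐ[Pd] Y := by
    filter_upwards [hmem] with ω hω
    have h := (Prod.ext_iff.1 hω).2
    dsimp only at h
    rw [← h]
    exact glue_restrict s (Y ω)
  rw [← Measure.map_prod_map _ _ (measurable_glue u a) (measurable_glue s b),
    Measure.map_map (measurable_glue u a) hXv, Measure.map_map (measurable_glue s b) hYt,
    Measure.map_map ((measurable_glue u a).prodMap (measurable_glue s b)) (hXv.prodMk hYt)] at h1
  rwa [← Measure.map_congr hXg, ← Measure.map_congr hYg,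
    ← Measure.map_congr (f := fun ω => (glue u a (uᶜ.restrict (X ω)),
      glue s b (sᶜ.restrict (Y ω)))) (hXg.prodMk hYg)]

/-- In each of the four cases the joint law is dominated by the product of the marginal laws. -/
lemma map_prodMk_absolutelyContinuous_of_case (hX : Measurable X) (hY : Measurable Y)
    (hcase : ContinuousCase P X Y ∨ MixedCase P X Y ∨ DiscreteCase P X Y ∨
      DiscreteContinuousCase P X Y) :
    P.map (fun ω => (X ω, Y ω)) ≪ (P.map X).prod (P.map Y) := by
  rcases hcase with ⟨h, -, -, -, -, hh, -⟩ | h | h | h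
  · have := hh.absolutelyContinuous
    rw [Measure.volume_eq_prod] at this
    exact RankTest.map_prodMk_absolutelyContinuous hX hY this
  · exact h.absolutelyContinuous hX hY
  · exact h.1.map_prodMk_absolutelyContinuous hX hY
  · exact h.1.map_prodMk_absolutelyContinuous hX hY

end

/-! ### A weak law of large numbers for U-statistics -/

section Counting

variable {ι : Type*} [Fintype ι] [DecidableEq ι] {N : ℕ}

lemma card_filter_apply_eq (b : ι) (c : Fin N) :
    N * (Finset.univ.filter fun J : ι → Fin N => J b = c).card = N ^ Fintype.card ι := by
  have h : (Finset.univ.filter fun J : ι → Fin N => J b = c) =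
      Fintype.piFinset (fun j => if j = b then {c} else Finset.univ) := by
    ext J
    simp only [Finset.mem_filter, Finset.mem_univ, true_and, Fintype.mem_piFinset]
    refine ⟨fun h j => ?_, fun h => by simpa using h b⟩
    by_cases hj : j = b
    · subst hj; simp [h]
    · simp [hj]
  rw [h, Fintype.card_piFinset, ← Finset.mul_prod_erase _ _ (Finset.mem_univ b)]
  have h2 : ∏ j ∈ Finset.univ.erase b, (if j = b then ({c} : Finset (Fin N)) else
      Finset.univ).card = N ^ (Fintype.card ι - 1) := by
    rw [Finset.prod_congr rfl (g := fun _ => N), Finset.prod_const, Finset.card_erase_of_mem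
      (Finset.mem_univ b), Finset.card_univ]
    intro j hj
    simp [Finset.ne_of_mem_erase hj]
  rw [h2, if_pos rfl, Finset.card_singleton, one_mul, ← pow_succ',
    Nat.sub_add_cancel (Fintype.card_pos_iff.2 ⟨b⟩)]

/-- Few index tuples have a repetition. -/
lemma card_filter_not_injective :
    N * (Finset.univ.filter fun I : ι → Fin N => ¬ Function.Injective I).card ≤
      Fintype.card ι ^ 2 * N ^ Fintype.card ι := by
  classical
  have hsub : (Finset.univ.filter fun I : ι → Fin N => ¬ Function.Injective I) ⊆
      (Finset.univ : Finset (ι × ι)).biUnion fun ab =>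
        if ab.1 = ab.2 then ∅ else Finset.univ.filter fun I : ι → Fin N => I ab.1 = I ab.2 := by
    intro I hI
    simp only [Finset.mem_filter, Finset.mem_univ, true_and, Function.Injective, not_forall] at hI
    obtain ⟨a, b, hab, hne⟩ := hI
    exact Finset.mem_biUnion.2 ⟨(a, b), Finset.mem_univ _, by simp [hne, hab]⟩
  have hab : ∀ ab : ι × ι, N * (if ab.1 = ab.2 then ∅ else
      Finset.univ.filter fun I : ι → Fin N => I ab.1 = I ab.2).card ≤ N ^ Fintype.card ι := by
    rintro ⟨a, b⟩
    by_cases h : a = b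
    · simp [h]
    · simp only [h, if_false]
      -- `I a` is determined by `I b`, so it can be overwritten by a free value in `Fin N`
      have hinj : N * (Finset.univ.filter fun I : ι → Fin N => I a = I b).card =
          ((Finset.univ : Finset (Fin N)) ×ˢ
            (Finset.univ.filter fun I : ι → Fin N => I a = I b)).card := by
        simp [Finset.card_product]
      have hpow : N ^ Fintype.card ι = (Finset.univ : Finset (ι → Fin N)).card := by simp
      rw [hinj, hpow]
      refine Finset.card_le_card_of_injOn (fun cI => Function.update cI.2 a cI.1)
        (fun _ _ => Finset.mem_coe.2 (Finset.mem_univ _)) ?_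
      rintro ⟨c, I⟩ hI ⟨d, J⟩ hJ hIJ
      simp only [Finset.coe_product, Set.mem_prod, Finset.coe_filter, Finset.mem_univ, true_and,
        Set.mem_ofPred_eq] at hI hJ hIJ
      have hne : ∀ k, k ≠ a → I k = J k := fun k hk => by
        have := congrFun hIJ k
        simpa [hk] using this
      refine Prod.ext (by simpa using congrFun hIJ a) (funext fun k => ?_)
      by_cases hk : k = a
      · change I k = J k
        rw [hk, hI.2, hJ.2, hne b (Ne.symm h)]
      · exact hne k hk
  calc N * (Finset.univ.filter fun I : ι → Fin N => ¬ Function.Injective I).card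
      ≤ N * ∑ ab : ι × ι, (if ab.1 = ab.2 then ∅ else
          Finset.univ.filter fun I : ι → Fin N => I ab.1 = I ab.2).card :=
        Nat.mul_le_mul_left _ ((Finset.card_le_card hsub).trans Finset.card_biUnion_le)
    _ ≤ ∑ _ab : ι × ι, N ^ Fintype.card ι := by
        rw [Finset.mul_sum]
        exact Finset.sum_le_sum fun ab _ => hab ab
    _ = _ := by simp [sq, Finset.card_univ]

/-- Few pairs of index tuples share an index. -/
lemma card_filter_exists_apply_eq :
    N * (Finset.univ.filter fun IJ : (ι → Fin N) × (ι → Fin N) => ∃ a b, IJ.1 a = IJ.2 b).card ≤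
      Fintype.card ι ^ 2 * (N ^ Fintype.card ι) ^ 2 := by
  classical
  have hsub : (Finset.univ.filter fun IJ : (ι → Fin N) × (ι → Fin N) => ∃ a b, IJ.1 a = IJ.2 b) ⊆
      (Finset.univ : Finset ((ι → Fin N) × ι × ι)).biUnion fun c =>
        (Finset.univ.filter fun J : ι → Fin N => J c.2.2 = c.1 c.2.1).image (Prod.mk c.1) := by
    rintro ⟨I, J⟩ hIJ
    simp only [Finset.mem_filter, Finset.mem_univ, true_and] at hIJ
    obtain ⟨a, b, hab⟩ := hIJ
    exact Finset.mem_biUnion.2 ⟨(I, a, b), Finset.mem_univ _, by simp [hab]⟩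
  calc _ ≤ N * ∑ c : (ι → Fin N) × ι × ι,
          (Finset.univ.filter fun J : ι → Fin N => J c.2.2 = c.1 c.2.1).card :=
        Nat.mul_le_mul_left _ ((Finset.card_le_card hsub).trans (Finset.card_biUnion_le.trans
          (Finset.sum_le_sum fun _ _ => Finset.card_image_le)))
    _ = ∑ _c : (ι → Fin N) × ι × ι, N ^ Fintype.card ι := by
        rw [Finset.mul_sum]
        exact Finset.sum_congr rfl fun c _ => card_filter_apply_eq _ _
    _ = _ := by
        simp [sq]
        ring

end Counting

section WeakLaw

variable {Ω Z ι : Type*} [MeasurableSpace Ω] [MeasurableSpace Z] {P : Measure Ω}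
  {μ : Measure Z} {z : ℕ → Ω → Z} [Fintype ι]

lemma map_comp_injective (hz : ∀ k, AEMeasurable (z k) P) (hindep : iIndepFun z P)
    (hlaw : ∀ k, P.map (z k) = μ) {I : ι → ℕ} (hI : Function.Injective I) :
    P.map (fun ω a => z (I a) ω) = Measure.pi fun _ => μ := by
  rw [(hindep.precomp hI).map_fun_eq_pi_map fun a => hz (I a)]
  simp [hlaw]

variable {φ : (ι → Z) → ℝ}

lemma integral_comp_injective (hz : ∀ k, AEMeasurable (z k) P) (hindep : iIndepFun z P)
    (hlaw : ∀ k, P.map (z k) = μ) (hφ : Measurable φ) {I : ι → ℕ} (hI : Function.Injective I) :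
    ∫ ω, φ (fun a => z (I a) ω) ∂P = ∫ w, φ w ∂Measure.pi fun _ => μ := by
  rw [← map_comp_injective hz hindep hlaw hI,
    integral_map (aemeasurable_pi_lambda _ fun a => hz (I a)) hφ.aestronglyMeasurable]

lemma integral_mul_comp_injective [SigmaFinite μ] (hz : ∀ k, AEMeasurable (z k) P)
    (hindep : iIndepFun z P) (hlaw : ∀ k, P.map (z k) = μ) (hφ : Measurable φ) {I J : ι → ℕ}
    (hIJ : Function.Injective (Sum.elim I J)) :
    ∫ ω, φ (fun a => z (I a) ω) * φ (fun a => z (J a) ω) ∂P =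
      (∫ w, φ w ∂Measure.pi fun _ => μ) * ∫ w, φ w ∂Measure.pi fun _ => μ := by
  have h := integral_comp_injective (φ := fun w : ι ⊕ ι → Z =>
    φ (fun a => w (Sum.inl a)) * φ (fun a => w (Sum.inr a))) hz hindep hlaw
    ((hφ.comp (measurable_pi_lambda _ fun a => measurable_pi_apply _)).mul
      (hφ.comp (measurable_pi_lambda _ fun a => measurable_pi_apply _))) hIJ
  simp only [Sum.elim_inl, Sum.elim_inr] at h
  rw [h, ← integral_prod_mul,
    ← (measurePreserving_sumPiEquivProdPi (fun _ : ι ⊕ ι => μ)).integral_comp'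
    (g := fun p : (ι → Z) × (ι → Z) => φ p.1 * φ p.2)]
  rfl

variable [DecidableEq ι] [IsProbabilityMeasure P] [SigmaFinite μ]

/-- The sum of the centred kernel over the index tuples without repetition has a second moment of
smaller order than the square of the number of tuples, because the terms of two disjoint tuples are
uncorrelated. -/
lemma integral_sum_injective_sq_le (hz : ∀ k, AEMeasurable (z k) P) (hindep : iIndepFun z P)
    (hlaw : ∀ k, P.map (z k) = μ) (hφ : Measurable φ) {K : ℝ} (hK : ∀ w, |φ w| ≤ K)
    (h0 : ∫ w, φ w ∂(Measure.pi fun _ => μ) = 0) (N : ℕ) :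
    N * ∫ ω, (∑ I : ι → Fin N with Function.Injective I, φ (fun a => z (I a) ω)) ^ 2 ∂P ≤
      K ^ 2 * (Fintype.card ι ^ 2 * (N ^ Fintype.card ι) ^ 2) := by
  classical
  have hm : ∀ I : ι → Fin N, AEStronglyMeasurable (fun ω => φ (fun a => z (I a) ω)) P := fun I =>
    (hφ.comp_aemeasurable (aemeasurable_pi_lambda _ fun a => hz (I a))).aestronglyMeasurable
  have hK2 : ∀ w w', ‖φ w * φ w'‖ ≤ K ^ 2 := fun w w' => by
    rw [norm_mul, sq]
    exact mul_le_mul (hK w) (hK w') (norm_nonneg _) ((abs_nonneg _).trans (hK w))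
  have hint : ∀ I J : ι → Fin N, Integrable
      (fun ω => φ (fun a => z (I a) ω) * φ (fun a => z (J a) ω)) P := fun I J =>
    Integrable.of_bound ((hm I).mul (hm J)) (K ^ 2) (Eventually.of_forall fun ω => hK2 _ _)
  set s := Finset.univ.filter fun I : ι → Fin N => Function.Injective I with hs
  set E := Finset.univ.filter fun IJ : (ι → Fin N) × (ι → Fin N) => ∃ a b, IJ.1 a = IJ.2 b with hE
  have hterm : ∀ IJ ∈ s ×ˢ s,
      ∫ ω, φ (fun a => z (IJ.1 a) ω) * φ (fun a => z (IJ.2 a) ω) ∂P ≤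
        if IJ ∈ E then K ^ 2 else 0 := by
    rintro ⟨I, J⟩ hIJs
    obtain ⟨hI, hJ⟩ := Finset.mem_product.1 hIJs
    split_ifs with h
    · refine (le_abs_self _).trans ((norm_integral_le_of_norm_le_const
        (Eventually.of_forall fun ω => hK2 _ _)).trans ?_)
      simp
    · simp only [hE, Finset.mem_filter, Finset.mem_univ, true_and, not_exists] at h
      have hI' : Function.Injective fun a => (I a : ℕ) :=
        Fin.val_injective.comp (Finset.mem_filter.1 hI).2
      have hJ' : Function.Injective fun a => (J a : ℕ) :=
        Fin.val_injective.comp (Finset.mem_filter.1 hJ).2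
      have hIJ := Function.Injective.sumElim hI' hJ' fun a b hab => h a b (Fin.ext hab)
      rw [integral_mul_comp_injective hz hindep hlaw hφ hIJ, h0, zero_mul]
  have hexp : ∫ ω, (∑ I ∈ s, φ (fun a => z (I a) ω)) ^ 2 ∂P =
      ∑ IJ ∈ s ×ˢ s, ∫ ω, φ (fun a => z (IJ.1 a) ω) * φ (fun a => z (IJ.2 a) ω) ∂P := by
    simp only [sq, Finset.sum_mul_sum, ← Finset.sum_product']
    exact integral_finsetSum _ fun IJ _ => hint IJ.1 IJ.2
  have hle : ∫ ω, (∑ I ∈ s, φ (fun a => z (I a) ω)) ^ 2 ∂P ≤ K ^ 2 * E.card := by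
    rw [hexp]
    refine (Finset.sum_le_sum hterm).trans ?_
    rw [Finset.sum_ite_mem, Finset.sum_const, nsmul_eq_mul, mul_comm]
    have : ((s ×ˢ s ∩ E).card : ℝ) ≤ E.card := by
      exact_mod_cast Finset.card_le_card Finset.inter_subset_right
    exact mul_le_mul_of_nonneg_left this (by positivity)
  have hcard : (N : ℝ) * E.card ≤ Fintype.card ι ^ 2 * (N ^ Fintype.card ι) ^ 2 := by
    exact_mod_cast card_filter_exists_apply_eq (ι := ι) (N := N)
  calc _ ≤ N * (K ^ 2 * E.card) := mul_le_mul_of_nonneg_left hle (by positivity)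
    _ = K ^ 2 * (N * E.card) := by ring
    _ ≤ _ := mul_le_mul_of_nonneg_left hcard (by positivity)

/-- The weak law of large numbers for U-statistics with a bounded centred kernel. -/
lemma tendsto_measure_sum_injective (hz : ∀ k, AEMeasurable (z k) P) (hindep : iIndepFun z P)
    (hlaw : ∀ k, P.map (z k) = μ) (hφ : Measurable φ) {K : ℝ} (hK : ∀ w, |φ w| ≤ K)
    (h0 : ∫ w, φ w ∂(Measure.pi fun _ => μ) = 0) {ε : ℝ} (hε : 0 < ε) :
    Tendsto (fun N : ℕ => P.real {ω | ε * (N : ℝ) ^ Fintype.card ι ≤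
      |∑ I : ι → Fin N with Function.Injective I, φ (fun a => z (I a) ω)|}) atTop (𝓝 0) := by
  have hbound : ∀ᶠ N : ℕ in atTop, P.real {ω | ε * (N : ℝ) ^ Fintype.card ι ≤
      |∑ I : ι → Fin N with Function.Injective I, φ (fun a => z (I a) ω)|} ≤
      K ^ 2 * Fintype.card ι ^ 2 / ε ^ 2 / N := by
    filter_upwards [eventually_gt_atTop 0] with N hN
    have hN' : (0 : ℝ) < N := by exact_mod_cast hN
    set V : Ω → ℝ := fun ω => ∑ I : ι → Fin N with Function.Injective I, φ (fun a => z (I a) ω)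
      with hV
    have hm : AEStronglyMeasurable V P := by
      refine Finset.aestronglyMeasurable_fun_sum _ fun I _ => ?_
      exact (hφ.comp_aemeasurable (aemeasurable_pi_lambda _ fun a => hz (I a))).aestronglyMeasurable
    have hb : ∀ ω, |V ω| ≤ (Finset.univ.filter fun I : ι → Fin N => Function.Injective I).card * K :=
      fun ω => by
        refine (Finset.abs_sum_le_sum_abs _ _).trans ?_
        rw [← nsmul_eq_mul]
        exact Finset.sum_le_card_nsmul _ _ _ fun I _ => hK _
    have hint : Integrable (fun ω => V ω ^ 2) P := by
      refine Integrable.of_bound (hm.pow 2)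
        (((Finset.univ.filter fun I : ι → Fin N => Function.Injective I).card * K) ^ 2)
        (Eventually.of_forall fun ω => ?_)
      rw [norm_pow]
      exact pow_le_pow_left₀ (norm_nonneg _) (hb ω) 2
    have hmarkov := mul_meas_ge_le_integral_of_nonneg
      (Eventually.of_forall fun ω => sq_nonneg (V ω)) hint ((ε * (N : ℝ) ^ Fintype.card ι) ^ 2)
    have hset : {ω | ε * (N : ℝ) ^ Fintype.card ι ≤ |V ω|} =
        {ω | (ε * (N : ℝ) ^ Fintype.card ι) ^ 2 ≤ V ω ^ 2} := by
      ext ω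
      simp only [Set.mem_ofPred_eq]
      rw [← sq_abs (V ω), sq_le_sq₀ (by positivity) (abs_nonneg _)]
    rw [hset, div_div, le_div_iff₀ (by positivity)]
    have h2 := integral_sum_injective_sq_le hz hindep hlaw hφ hK h0 N
    have h3 := mul_le_mul_of_nonneg_left hmarkov hN'.le
    have hpow : (0 : ℝ) < ((N : ℝ) ^ Fintype.card ι) ^ 2 := by positivity
    refine le_of_mul_le_mul_right ?_ hpow
    calc _ = N * ((ε * (N : ℝ) ^ Fintype.card ι) ^ 2 *
          P.real {ω | (ε * (N : ℝ) ^ Fintype.card ι) ^ 2 ≤ V ω ^ 2}) := by ring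
      _ ≤ _ := h3.trans (h2.trans (le_of_eq (by ring)))
  refine squeeze_zero' (Eventually.of_forall fun N => measureReal_nonneg) hbound ?_
  exact tendsto_const_nhds.div_atTop tendsto_natCast_atTop_atTop

end WeakLaw

/-! ### Two norms, and a U-statistic below the test statistic -/

section NormedBy

variable {p q : ℕ}

/-- The space `Fin p → ℝ` with the norm `n` in place of the sup norm. It keeps the product
σ-algebra of `Fin p → ℝ`, which is the Borel σ-algebra of `n` too. -/
def NormedBy (n : Seminorm ℝ (Fin p → ℝ)) (_ : ∀ v, n v = 0 → v = 0) : Type :=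
  Fin p → ℝ

variable (n : Seminorm ℝ (Fin p → ℝ)) (hn : ∀ v, n v = 0 → v = 0)

noncomputable instance : AddCommGroup (NormedBy n hn) := inferInstanceAs (AddCommGroup (Fin p → ℝ))

noncomputable instance : Module ℝ (NormedBy n hn) := inferInstanceAs (Module ℝ (Fin p → ℝ))

instance : FiniteDimensional ℝ (NormedBy n hn) :=
  inferInstanceAs (FiniteDimensional ℝ (Fin p → ℝ))

instance : MeasurableSpace (NormedBy n hn) := inferInstanceAs (MeasurableSpace (Fin p → ℝ))

noncomputable instance : Norm (NormedBy n hn) := ⟨fun v => n v⟩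

lemma NormedBy.core : NormedSpace.Core ℝ (NormedBy n hn) where
  norm_nonneg v := apply_nonneg n v
  norm_smul c v := map_smul_eq_mul n c v
  norm_triangle v w := map_add_le_add n v w
  norm_eq_zero_iff v := ⟨hn v, fun h => h ▸ map_zero n⟩

noncomputable instance : NormedAddCommGroup (NormedBy n hn) :=
  NormedAddCommGroup.ofCore (NormedBy.core n hn)

noncomputable instance : NormedSpace ℝ (NormedBy n hn) := NormedSpace.ofCore (NormedBy.core n hn)

instance : BorelSpace (NormedBy n hn) := by
  -- the topologies of two norms on a finite-dimensional space agree
  let e : (Fin p → ℝ) ≃ₗ[ℝ] NormedBy n hn := LinearEquiv.refl ℝ (Fin p → ℝ)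
  have h := e.toContinuousLinearEquiv.toHomeomorph.isInducing.eq_induced
  have h' : (inferInstance : TopologicalSpace (Fin p → ℝ)) =
      (inferInstance : TopologicalSpace (NormedBy n hn)) := 
    h.trans (@induced_id (Fin p → ℝ) (inferInstance : TopologicalSpace (NormedBy n hn)))
  refine ⟨?_⟩
  have hb : (inferInstance : MeasurableSpace (Fin p → ℝ)) = borel (Fin p → ℝ) :=
    BorelSpace.measurable_eq
  exact hb.trans (congrArg (@borel (Fin p → ℝ)) h')

lemma NormedBy.closedBall_eq (a b : NormedBy n hn) :
    Metric.closedBall a (dist b a) = {w | ‖a - w‖ ≤ ‖a - b‖} := by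
  ext w
  rw [Metric.mem_closedBall, dist_comm, dist_comm b, dist_eq_norm, dist_eq_norm, Set.mem_ofPred_eq]

/-- `eq_prod_of_measure_closedBall_eq` for the balls of two given norms. -/
theorem eq_prod_of_measure_seminorm_ball_eq {nX : Seminorm ℝ (Fin p → ℝ)}
    (hnX : ∀ v, nX v = 0 → v = 0) {nY : Seminorm ℝ (Fin q → ℝ)} (hnY : ∀ v, nY v = 0 → v = 0)
    (μ : Measure ((Fin p → ℝ) × (Fin q → ℝ))) [IsProbabilityMeasure μ]
    (hac : μ ≪ μ.fst.prod μ.snd)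
    (heq : ∀ᵐ z ∂μ, ∀ᵐ z' ∂μ,
      μ ({w | nX (z.1 - w) ≤ nX (z.1 - z'.1)} ×ˢ {w | nY (z.2 - w) ≤ nY (z.2 - z'.2)}) =
      μ.fst {w | nX (z.1 - w) ≤ nX (z.1 - z'.1)} * μ.snd {w | nY (z.2 - w) ≤ nY (z.2 - z'.2)}) :
    μ = μ.fst.prod μ.snd := by
  let μ' : Measure (NormedBy nX hnX × NormedBy nY hnY) := μ
  have hμ' : IsProbabilityMeasure μ' := ‹IsProbabilityMeasure μ›
  refine eq_prod_of_measure_closedBall_eq μ' hac ?_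
  filter_upwards [heq] with z hz
  filter_upwards [hz] with z' hz'
  rw [NormedBy.closedBall_eq, NormedBy.closedBall_eq]
  exact hz'

lemma continuous_seminorm (n : Seminorm ℝ (Fin p → ℝ)) : Continuous n :=
  n.convexOn.locallyLipschitz.continuous

end NormedBy

section Kernel

variable {κ : Type*}

/-- A kernel in four arguments whose sums and integrals are squares of determinants of
`2 × 2` tables. -/
def quad (r c : κ → ℝ) (w : Fin 4 → κ) : ℝ :=
  r (w 0) * (c (w 1) - c (w 0)) * (r (w 2) * (c (w 3) - c (w 2)))

lemma quad_eq (r c : κ → ℝ) (w : Fin 4 → κ) :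
    quad r c w = (∏ a, ![r, c, r, c] a (w a)) - (∏ a, ![r, c, r * c, 1] a (w a)) -
      (∏ a, ![r * c, 1, r, c] a (w a)) + ∏ a, ![r * c, 1, r * c, 1] a (w a) := by
  simp [quad, Fin.prod_univ_four]
  ring

lemma sum_quad [Fintype κ] (r c : κ → ℝ) :
    ∑ w : Fin 4 → κ, quad r c w =
      (Fintype.card κ * ∑ k, r k * c k - (∑ k, r k) * ∑ k, c k) ^ 2 := by
  classical
  simp only [quad_eq, Finset.sum_add_distrib, Finset.sum_sub_distrib]
  simp only [← Fintype.piFinset_univ, ← Finset.prod_univ_sum]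
  simp [Fin.prod_univ_four]
  ring

lemma integral_quad [MeasurableSpace κ] (μ : Measure κ) [IsProbabilityMeasure μ] {r c : κ → ℝ}
    (hr : Integrable r μ) (hc : Integrable c μ) (hrc : Integrable (r * c) μ) :
    ∫ w, quad r c w ∂(Measure.pi fun _ => μ) =
      ((∫ w, r w * c w ∂μ) - (∫ w, r w ∂μ) * ∫ w, c w ∂μ) ^ 2 := by
  have h1 : Integrable (1 : κ → ℝ) μ := integrable_const 1
  let m : (Fin 4 → κ → ℝ) → (Fin 4 → κ) → ℝ := fun f w => ∏ a, f a (w a)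
  have hint : ∀ f : Fin 4 → κ → ℝ, (∀ a, Integrable (f a) μ) →
      Integrable (m f) (Measure.pi fun _ => μ) :=
    fun f hf => Integrable.fintype_prod hf
  have ha := hint ![r, c, r, c] (by simp [Fin.forall_fin_succ, *])
  have hb := hint ![r, c, r * c, 1] (by simp [Fin.forall_fin_succ, *])
  have hd := hint ![r * c, 1, r, c] (by simp [Fin.forall_fin_succ, *])
  have he := hint ![r * c, 1, r * c, 1] (by simp [Fin.forall_fin_succ, *])
  have hq : (fun w => quad r c w) =
      m ![r, c, r, c] - m ![r, c, r * c, 1] - m ![r * c, 1, r, c] + m ![r * c, 1, r * c, 1] :=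
    funext fun w => quad_eq r c w
  rw [hq, integral_add' ((ha.sub hb).sub hd) he, integral_sub' (ha.sub hb) hd, integral_sub' ha hb]
  simp only [m, integral_fintype_prod_eq_prod]
  simp [Fin.prod_univ_four]
  ring

lemma ind_nonneg (a : Prop) : 0 ≤ ind a := by
  unfold ind; split_ifs <;> simp

lemma ind_le_one (a : Prop) : ind a ≤ 1 := by
  unfold ind; split_ifs <;> simp

lemma abs_quad_le {r c : κ → ℝ} (hr0 : ∀ k, 0 ≤ r k) (hr1 : ∀ k, r k ≤ 1) (hc0 : ∀ k, 0 ≤ c k)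
    (hc1 : ∀ k, c k ≤ 1) (w : Fin 4 → κ) : |quad r c w| ≤ 1 := by
  have h : ∀ k l, |r k * (c l - c k)| ≤ 1 := fun k l => by
    rw [abs_mul, abs_of_nonneg (hr0 k)]
    refine mul_le_one₀ (hr1 k) (abs_nonneg _) (abs_le.2 ⟨?_, ?_⟩)
    · linarith [hc0 l, hc1 k]
    · linarith [hc0 k, hc1 l]
  rw [quad, abs_mul]
  exact mul_le_one₀ (h _ _) (abs_nonneg _) (h _ _)

/-- The chi-square statistic in terms of the determinant of the table, by the inequality of the
arithmetic and geometric means for the margins. -/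
lemma le_chiSq [Fintype κ] [Nonempty κ] {r c : κ → ℝ} (hr : ∀ k, r k ^ 2 = r k)
    (hc : ∀ k, c k ^ 2 = c k) :
    16 * (Fintype.card κ * ∑ k, r k * c k - (∑ k, r k) * ∑ k, c k) ^ 2 / Fintype.card κ ^ 3 ≤
      chiSq r c := by
  have hcs := Finset.sum_mul_sq_le_sq_mul_sq Finset.univ
    (fun k => r k - (∑ l, r l) / Fintype.card κ) (fun k => c k - (∑ l, c l) / Fintype.card κ)
  have hr2 := sum_centred_mul r r
  have hc2 := sum_centred_mul c c
  have hrc := sum_centred_mul r c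
  simp only [← sq, hr, hc] at hr2 hc2
  have hpos : (0 : ℝ) < Fintype.card κ := by exact_mod_cast Fintype.card_pos
  have hR0 : 0 ≤ ∑ k, r k := Finset.sum_nonneg fun k _ => hr k ▸ sq_nonneg _
  have hC0 : 0 ≤ ∑ k, c k := Finset.sum_nonneg fun k _ => hc k ▸ sq_nonneg _
  simp only [chiSq]
  set n : ℝ := (Fintype.card κ : ℝ) with hn
  set R := ∑ k, r k
  set C := ∑ k, c k
  set a := ∑ k, (r k - R / n) ^ 2 with ha
  set b := ∑ k, (c k - C / n) ^ 2 with hb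
  have ha0 : 0 ≤ a := Finset.sum_nonneg fun k _ => sq_nonneg _
  have hb0 : 0 ≤ b := Finset.sum_nonneg fun k _ => sq_nonneg _
  rw [← hrc, mul_pow]
  have hle := mul_le_mul_of_nonneg_left hcs (sq_nonneg n)
  have e1 : R * (n - R) = n * a := by linear_combination -hr2
  have e2 : C * (n - C) = n * b := by linear_combination -hc2
  split_ifs with h
  · have hab : a * b = 0 := by
      have : n * a = 0 ∨ n * b = 0 := by
        rcases h with h | h | h | h <;> simp [← e1, ← e2, h]
      rcases this with h | h
      · simp [(mul_eq_zero.1 h).resolve_left hpos.ne']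
      · simp [(mul_eq_zero.1 h).resolve_left hpos.ne']
    have h0 : n ^ 2 * (∑ k, (r k - R / n) * (c k - C / n)) ^ 2 = 0 := by
      refine le_antisymm (hle.trans ?_) (by positivity)
      rw [hab, mul_zero]
    rw [h0, mul_zero, zero_div]
  · push Not at h
    obtain ⟨h1, h2, h3, h4⟩ := h
    have hM : R * (n - R) * C * (n - C) = (n * a) * (n * b) := by rw [← e1, ← e2]; ring
    have hMpos : 0 < (n * a) * (n * b) :=
      lt_of_le_of_ne (by positivity) (hM ▸ by positivity : (n * a) * (n * b) ≠ 0).symm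
    have hRn : n * a ≤ n ^ 2 / 4 := by rw [← e1]; nlinarith [sq_nonneg (n - 2 * R)]
    have hCn : n * b ≤ n ^ 2 / 4 := by rw [← e2]; nlinarith [sq_nonneg (n - 2 * C)]
    have hMle : (n * a) * (n * b) ≤ n ^ 2 / 4 * (n ^ 2 / 4) :=
      mul_le_mul hRn hCn (by positivity) (by positivity)
    rw [hM, div_le_div_iff₀ (by positivity) hMpos]
    have hQ : 0 ≤ n ^ 2 * (∑ k, (r k - R / n) * (c k - C / n)) ^ 2 := by positivity
    nlinarith [mul_le_mul_of_nonneg_left hMle hQ]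

end Kernel

section LowerBound

variable {p q : ℕ} (nX : Seminorm ℝ (Fin p → ℝ)) (nY : Seminorm ℝ (Fin q → ℝ))

/-- The indicator of the event that the first component of `w` lies in the closed ball around that of
`z` with that of `z'` on its boundary. -/
noncomputable def kernelX (z z' w : (Fin p → ℝ) × (Fin q → ℝ)) : ℝ :=
  ind (nX (z.1 - w.1) ≤ nX (z.1 - z'.1))

/-- The indicator of the event that the second component of `w` lies in the closed ball around that
of `z` with that of `z'` on its boundary. -/
noncomputable def kernelY (z z' w : (Fin p → ℝ) × (Fin q → ℝ)) : ℝ :=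
  ind (nY (z.2 - w.2) ≤ nY (z.2 - z'.2))

/-- The kernel of the U-statistic that bounds the test statistic from below: the first two arguments
determine the balls, the other four are classified. -/
noncomputable def kernel (v : Fin 2 ⊕ Fin 4 → (Fin p → ℝ) × (Fin q → ℝ)) : ℝ :=
  quad (kernelX nX (v (.inl 0)) (v (.inl 1))) (kernelY nY (v (.inl 0)) (v (.inl 1)))
    (fun a => v (.inr a))

lemma abs_kernel_le (v : Fin 2 ⊕ Fin 4 → (Fin p → ℝ) × (Fin q → ℝ)) : |kernel nX nY v| ≤ 1 :=
  abs_quad_le (fun _ => ind_nonneg _) (fun _ => ind_le_one _) (fun _ => ind_nonneg _)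
    (fun _ => ind_le_one _) _

lemma measurable_ind {α : Type*} [MeasurableSpace α] {Q : α → Prop} (hQ : MeasurableSet {a | Q a}) :
    Measurable fun a => ind (Q a) := by
  classical
  have : (fun a => ind (Q a)) = {a | Q a}.indicator 1 := by
    funext a
    by_cases h : Q a <;> simp [ind, h]
  rw [this]
  exact measurable_one.indicator hQ

lemma measurable_kernelX {α : Type*} [MeasurableSpace α]
    {f g h : α → (Fin p → ℝ) × (Fin q → ℝ)} (hf : Measurable f) (hg : Measurable g)
    (hh : Measurable h) : Measurable fun a => kernelX nX (f a) (g a) (h a) :=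
  measurable_ind (measurableSet_le
    ((continuous_seminorm nX).measurable.comp (hf.fst.sub hh.fst))
    ((continuous_seminorm nX).measurable.comp (hf.fst.sub hg.fst)))

lemma measurable_kernelY {α : Type*} [MeasurableSpace α]
    {f g h : α → (Fin p → ℝ) × (Fin q → ℝ)} (hf : Measurable f) (hg : Measurable g)
    (hh : Measurable h) : Measurable fun a => kernelY nY (f a) (g a) (h a) :=
  measurable_ind (measurableSet_le
    ((continuous_seminorm nY).measurable.comp (hf.snd.sub hh.snd))
    ((continuous_seminorm nY).measurable.comp (hf.snd.sub hg.snd)))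

lemma measurable_kernel : Measurable (kernel nX nY) := by
  have hX : ∀ a : Fin 4, Measurable fun v : Fin 2 ⊕ Fin 4 → (Fin p → ℝ) × (Fin q → ℝ) =>
      kernelX nX (v (.inl 0)) (v (.inl 1)) (v (.inr a)) := fun a =>
    measurable_kernelX nX (measurable_pi_apply _) (measurable_pi_apply _) (measurable_pi_apply _)
  have hY : ∀ a : Fin 4, Measurable fun v : Fin 2 ⊕ Fin 4 → (Fin p → ℝ) × (Fin q → ℝ) =>
      kernelY nY (v (.inl 0)) (v (.inl 1)) (v (.inr a)) := fun a =>
    measurable_kernelY nY (measurable_pi_apply _) (measurable_pi_apply _) (measurable_pi_apply _)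
  exact ((hX 0).mul ((hY 1).sub (hY 0))).mul ((hX 2).mul ((hY 3).sub (hY 2)))

lemma sum_fun_sum {N : ℕ} (G : (Fin 2 ⊕ Fin 4 → Fin N) → ℝ) :
    ∑ I, G I = ∑ i, ∑ j, ∑ w : Fin 4 → Fin N, G (Sum.elim ![i, j] w) := by
  rw [← Equiv.sum_comp (Equiv.sumArrowEquivProdArrow (Fin 2) (Fin 4) (Fin N)).symm,
    Fintype.sum_prod_type, ← Equiv.sum_comp (finTwoArrowEquiv (Fin N)).symm, Fintype.sum_prod_type]
  rfl

variable {N : ℕ} (x : Fin N → Fin p → ℝ) (y : Fin N → Fin q → ℝ)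

lemma le_S {i j : Fin N} (hij : i ≠ j) (hN : 4 ≤ N) :
    16 / (N : ℝ) ^ 3 * ∑ w : Fin 4 → {k // k ≠ i ∧ k ≠ j},
      kernel nX nY (fun a => (x (Sum.elim ![i, j] (fun b => (w b : Fin N)) a),
        y (Sum.elim ![i, j] (fun b => (w b : Fin N)) a))) ≤ S nX nY x y i j := by
  have hcard := card_ne_ne hij
  have : Nonempty {k // k ≠ i ∧ k ≠ j} := Fintype.card_pos_iff.1 (by omega)
  rw [S_eq_chiSq nX nY x y hij]
  refine le_trans ?_ (le_chiSq (fun _ => ind_sq _) (fun _ => ind_sq _))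
  rw [← sum_quad, mul_div_right_comm]
  have hcle : (Fintype.card {k // k ≠ i ∧ k ≠ j} : ℝ) ≤ N := by
    rw [hcard]; exact_mod_cast Nat.sub_le N 2
  have hpos : (0 : ℝ) < Fintype.card {k // k ≠ i ∧ k ≠ j} := by exact_mod_cast Fintype.card_pos
  have h0 := sum_quad (fun k : {k // k ≠ i ∧ k ≠ j} => ind (Near nX x i j k))
    (fun k => ind (Near nY y i j k))
  refine mul_le_mul_of_nonneg_right ?_ (h0 ▸ sq_nonneg _)
  gcongr

/-- The test statistic is at least `16 / N ^ 3` times the sum of the kernel over all tuples without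
repetition, up to the contribution of the tuples that repeat an index. -/
lemma le_T (hN : 4 ≤ N) :
    16 / (N : ℝ) ^ 3 * (∑ I : Fin 2 ⊕ Fin 4 → Fin N with Function.Injective I,
      kernel nX nY (fun a => (x (I a), y (I a))) - 36 * (N : ℝ) ^ 5) ≤ T nX nY x y := by
  classical
  have hN0 : (0 : ℝ) < N := by exact_mod_cast (by omega : 0 < N)
  set g : (Fin 2 ⊕ Fin 4 → Fin N) → ℝ := fun I => kernel nX nY (fun a => (x (I a), y (I a)))
    with hg
  -- the tuples that occur in the test statistic may repeat one of the last four indices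
  let Q : (Fin 2 ⊕ Fin 4 → Fin N) → Prop := fun I =>
    I (.inl 0) ≠ I (.inl 1) ∧ ∀ a, I (.inr a) ≠ I (.inl 0) ∧ I (.inr a) ≠ I (.inl 1)
  have hbad : ((Finset.univ.filter fun I : Fin 2 ⊕ Fin 4 → Fin N =>
      ¬ Function.Injective I).card : ℝ) ≤ 36 * (N : ℝ) ^ 5 := by
    have h := card_filter_not_injective (ι := Fin 2 ⊕ Fin 4) (N := N)
    have h' : (N : ℝ) * (Finset.univ.filter fun I : Fin 2 ⊕ Fin 4 → Fin N =>
        ¬ Function.Injective I).card ≤ 36 * N ^ 6 := by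
      have : Fintype.card (Fin 2 ⊕ Fin 4) = 6 := by simp
      rw [this] at h
      exact_mod_cast h
    refine le_of_mul_le_mul_left (h'.trans (le_of_eq (by ring))) hN0
  have h1 : ∑ I : Fin 2 ⊕ Fin 4 → Fin N with Function.Injective I, g I - 36 * (N : ℝ) ^ 5 ≤
      ∑ I : Fin 2 ⊕ Fin 4 → Fin N with Q I, g I := by
    have hsplit := Finset.sum_filter_add_sum_filter_not (Finset.univ.filter Q)
      (fun I => Function.Injective I) g
    have hinj : (Finset.univ.filter Q).filter (fun I => Function.Injective I) =
        Finset.univ.filter fun I : Fin 2 ⊕ Fin 4 → Fin N => Function.Injective I := by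
      ext I
      simp only [Finset.mem_filter, Finset.mem_univ, true_and, and_iff_right_iff_imp]
      intro hI
      exact ⟨fun h => by simpa using hI h, fun a => ⟨fun h => by simpa using hI h,
        fun h => by simpa using hI h⟩⟩
    have hlow : -(36 * (N : ℝ) ^ 5) ≤
        ∑ I ∈ (Finset.univ.filter Q).filter (fun I => ¬ Function.Injective I), g I := by
      have habs : |∑ I ∈ (Finset.univ.filter Q).filter (fun I => ¬ Function.Injective I), g I| ≤
          36 * (N : ℝ) ^ 5 := by
        refine (Finset.abs_sum_le_sum_abs _ _).trans ?_
        refine (Finset.sum_le_card_nsmul _ _ 1 fun I _ => abs_kernel_le nX nY _).trans ?_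
        rw [nsmul_eq_mul, mul_one]
        refine le_trans ?_ hbad
        exact_mod_cast Finset.card_le_card (Finset.filter_subset_filter _ (Finset.subset_univ _))
      exact (abs_le.1 habs).1
    rw [hinj] at hsplit
    linarith
  have h2 : ∑ I : Fin 2 ⊕ Fin 4 → Fin N with Q I, g I =
      ∑ i : Fin N, ∑ j ∈ Finset.univ.erase i, ∑ w : Fin 4 → {k // k ≠ i ∧ k ≠ j},
        g (Sum.elim ![i, j] fun b => (w b : Fin N)) := by
    rw [Finset.sum_filter, sum_fun_sum]
    refine Finset.sum_congr rfl fun i _ => ?_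
    rw [← Finset.add_sum_erase _ _ (Finset.mem_univ i)]
    have hzero : ∑ w : Fin 4 → Fin N,
        (if Q (Sum.elim ![i, i] w) then g (Sum.elim ![i, i] w) else 0) = 0 :=
      Finset.sum_eq_zero fun w _ => if_neg fun h => h.1 rfl
    rw [hzero, zero_add]
    refine Finset.sum_congr rfl fun j hj => ?_
    have hij : i ≠ j := (Finset.ne_of_mem_erase hj).symm
    rw [← Finset.sum_filter, Finset.sum_subtype (p := fun w : Fin 4 → Fin N =>
      ∀ a, w a ≠ i ∧ w a ≠ j) _ (fun w => by simp [Q, hij])]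
    exact Fintype.sum_equiv (Equiv.subtypePiEquivPi (p := fun _ k => k ≠ i ∧ k ≠ j)) _ _
      fun w => rfl
  calc _ ≤ 16 / (N : ℝ) ^ 3 * ∑ I : Fin 2 ⊕ Fin 4 → Fin N with Q I, g I :=
        mul_le_mul_of_nonneg_left h1 (by positivity)
    _ ≤ _ := by
        rw [h2, T, Finset.mul_sum]
        refine Finset.sum_le_sum fun i _ => ?_
        rw [Finset.mul_sum]
        exact Finset.sum_le_sum fun j hj =>
          le_S nX nY x y (Finset.ne_of_mem_erase hj).symm hN

end LowerBound

/-! ### The limit of the U-statistic, and consistency -/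

section Mean

variable {p q : ℕ} (nX : Seminorm ℝ (Fin p → ℝ)) (nY : Seminorm ℝ (Fin q → ℝ))

lemma ind_and (a b : Prop) : ind (a ∧ b) = ind a * ind b := by
  by_cases ha : a <;> by_cases hb : b <;> simp [ind, ha, hb]

lemma integral_ind_mem {α : Type*} [MeasurableSpace α] {μ : Measure α} {s : Set α}
    (hs : MeasurableSet s) : ∫ a, ind (a ∈ s) ∂μ = μ.real s := by
  classical
  have : (fun a => ind (a ∈ s)) = s.indicator 1 := by
    funext a
    by_cases h : a ∈ s <;> simp [ind, h]
  rw [this, integral_indicator_one hs]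

/-- The mean of the kernel is the mean square of the dependence between the events that the two
components lie in the balls determined by two random points. -/
lemma integral_kernel (μ : Measure ((Fin p → ℝ) × (Fin q → ℝ))) [IsProbabilityMeasure μ] :
    ∫ v, kernel nX nY v ∂(Measure.pi fun _ => μ) =
      ∫ zz : ((Fin p → ℝ) × (Fin q → ℝ)) × ((Fin p → ℝ) × (Fin q → ℝ)),
        ((∫ w, kernelX nX zz.1 zz.2 w * kernelY nY zz.1 zz.2 w ∂μ) -
          (∫ w, kernelX nX zz.1 zz.2 w ∂μ) * ∫ w, kernelY nY zz.1 zz.2 w ∂μ) ^ 2 ∂μ.prod μ := by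
  let Z := (Fin p → ℝ) × (Fin q → ℝ)
  have hint : Integrable (fun vw : (Fin 2 → Z) × (Fin 4 → Z) => kernel nX nY (Sum.elim vw.1 vw.2))
      ((Measure.pi fun _ => μ).prod (Measure.pi fun _ => μ)) := by
    refine Integrable.of_bound (Measurable.aestronglyMeasurable ?_) 1
      (Eventually.of_forall fun vw => abs_kernel_le nX nY _)
    refine (measurable_kernel nX nY).comp (measurable_pi_lambda _ ?_)
    rintro (a | a)
    · exact (measurable_pi_apply a).comp measurable_fst
    · exact (measurable_pi_apply a).comp measurable_snd
  have h1 : ∫ v, kernel nX nY v ∂(Measure.pi fun _ => μ) =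
      ∫ vw : (Fin 2 → Z) × (Fin 4 → Z), kernel nX nY (Sum.elim vw.1 vw.2)
        ∂((Measure.pi fun _ => μ).prod (Measure.pi fun _ => μ)) := by
    rw [← (measurePreserving_sumPiEquivProdPi_symm (fun _ : Fin 2 ⊕ Fin 4 => μ)).integral_comp']
    rfl
  have hbound : ∀ {f : Z → ℝ}, Measurable f → (∀ w, ‖f w‖ ≤ 1) → Integrable f μ :=
    fun hf hb => Integrable.of_bound hf.aestronglyMeasurable 1 (Eventually.of_forall hb)
  have hX : ∀ z z', Measurable (kernelX (q := q) nX z z') := fun z z' =>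
    measurable_kernelX nX measurable_const measurable_const measurable_id
  have hY : ∀ z z', Measurable (kernelY (p := p) nY z z') := fun z z' =>
    measurable_kernelY nY measurable_const measurable_const measurable_id
  have hX1 : ∀ z z' w, ‖kernelX (q := q) nX z z' w‖ ≤ 1 := fun z z' w => by
    rw [Real.norm_eq_abs, kernelX, abs_of_nonneg (ind_nonneg _)]
    exact ind_le_one _
  have hY1 : ∀ z z' w, ‖kernelY (p := p) nY z z' w‖ ≤ 1 := fun z z' w => by
    rw [Real.norm_eq_abs, kernelY, abs_of_nonneg (ind_nonneg _)]
    exact ind_le_one _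
  have h2 : ∀ v : Fin 2 → Z, ∫ w, kernel nX nY (Sum.elim v w) ∂(Measure.pi fun _ => μ) =
      ((∫ w, kernelX nX (v 0) (v 1) w * kernelY nY (v 0) (v 1) w ∂μ) -
          (∫ w, kernelX nX (v 0) (v 1) w ∂μ) * ∫ w, kernelY nY (v 0) (v 1) w ∂μ) ^ 2 := fun v =>
    integral_quad μ (hbound (hX _ _) (hX1 _ _)) (hbound (hY _ _) (hY1 _ _))
      (hbound ((hX _ _).mul (hY _ _)) fun w => by
        rw [Pi.mul_apply, norm_mul]
        exact mul_le_one₀ (hX1 _ _ _) (norm_nonneg _) (hY1 _ _ _))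
  rw [h1, integral_prod _ hint]
  rw [← (measurePreserving_finTwoArrow μ).integral_comp']
  exact integral_congr_ae (Eventually.of_forall h2)

/-- The mean of the kernel is positive unless the components are independent. -/
lemma integral_kernel_pos {nX : Seminorm ℝ (Fin p → ℝ)} (hnX : ∀ v, nX v = 0 → v = 0)
    {nY : Seminorm ℝ (Fin q → ℝ)} (hnY : ∀ v, nY v = 0 → v = 0)
    (μ : Measure ((Fin p → ℝ) × (Fin q → ℝ))) [IsProbabilityMeasure μ]
    (hac : μ ≪ μ.fst.prod μ.snd) (hdep : μ ≠ μ.fst.prod μ.snd) :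
    0 < ∫ v, kernel nX nY v ∂(Measure.pi fun _ => μ) := by
  let Z := (Fin p → ℝ) × (Fin q → ℝ)
  rw [integral_kernel]
  refine lt_of_le_of_ne (integral_nonneg fun _ => sq_nonneg _) fun h0 => hdep ?_
  have hmX : Measurable fun u : (Z × Z) × Z => kernelX nX u.1.1 u.1.2 u.2 :=
    measurable_kernelX nX measurable_fst.fst measurable_fst.snd measurable_snd
  have hmY : Measurable fun u : (Z × Z) × Z => kernelY nY u.1.1 u.1.2 u.2 :=
    measurable_kernelY nY measurable_fst.fst measurable_fst.snd measurable_snd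
  have hm : StronglyMeasurable fun zz : Z × Z =>
      ((∫ w, kernelX nX zz.1 zz.2 w * kernelY nY zz.1 zz.2 w ∂μ) -
        (∫ w, kernelX nX zz.1 zz.2 w ∂μ) * ∫ w, kernelY nY zz.1 zz.2 w ∂μ) ^ 2 :=
    (((hmX.mul hmY).stronglyMeasurable.integral_prod_right').sub
      (hmX.stronglyMeasurable.integral_prod_right'.mul
        hmY.stronglyMeasurable.integral_prod_right')).pow 2
  have hballX : ∀ zz : Z × Z,
      MeasurableSet {w : Fin p → ℝ | nX (zz.1.1 - w) ≤ nX (zz.1.1 - zz.2.1)} :=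
    fun zz => measurableSet_le
      ((continuous_seminorm nX).comp (continuous_const.sub continuous_id)).measurable
      measurable_const
  have hballY : ∀ zz : Z × Z,
      MeasurableSet {w : Fin q → ℝ | nY (zz.1.2 - w) ≤ nY (zz.1.2 - zz.2.2)} :=
    fun zz => measurableSet_le
      ((continuous_seminorm nY).comp (continuous_const.sub continuous_id)).measurable
      measurable_const
  have hval : ∀ zz : Z × Z,
      ((∫ w, kernelX nX zz.1 zz.2 w * kernelY nY zz.1 zz.2 w ∂μ) -
        (∫ w, kernelX nX zz.1 zz.2 w ∂μ) * ∫ w, kernelY nY zz.1 zz.2 w ∂μ) =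
      μ.real ({w | nX (zz.1.1 - w) ≤ nX (zz.1.1 - zz.2.1)} ×ˢ
        {w | nY (zz.1.2 - w) ≤ nY (zz.1.2 - zz.2.2)}) -
      μ.fst.real {w | nX (zz.1.1 - w) ≤ nX (zz.1.1 - zz.2.1)} *
        μ.snd.real {w | nY (zz.1.2 - w) ≤ nY (zz.1.2 - zz.2.2)} := by
    intro zz
    have hprod : ∀ w : Z, kernelX nX zz.1 zz.2 w * kernelY nY zz.1 zz.2 w =
        ind (w ∈ {w | nX (zz.1.1 - w) ≤ nX (zz.1.1 - zz.2.1)} ×ˢ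
          {w | nY (zz.1.2 - w) ≤ nY (zz.1.2 - zz.2.2)}) := fun w =>
      (ind_and _ _).symm
    simp only [hprod]
    have hXint : ∫ w, kernelX nX zz.1 zz.2 w ∂μ =
        μ.real (Prod.fst ⁻¹' {w | nX (zz.1.1 - w) ≤ nX (zz.1.1 - zz.2.1)}) :=
      integral_ind_mem (measurable_fst (hballX zz))
    have hYint : ∫ w, kernelY nY zz.1 zz.2 w ∂μ =
        μ.real (Prod.snd ⁻¹' {w | nY (zz.1.2 - w) ≤ nY (zz.1.2 - zz.2.2)}) :=
      integral_ind_mem (measurable_snd (hballY zz))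
    rw [integral_ind_mem ((hballX zz).prod (hballY zz)), hXint, hYint, measureReal_def μ.fst,
      measureReal_def μ.snd, Measure.fst_apply (hballX zz), Measure.snd_apply (hballY zz)]
    rfl
  have hbd : ∀ zz : Z × Z, ‖((∫ w, kernelX nX zz.1 zz.2 w * kernelY nY zz.1 zz.2 w ∂μ) -
        (∫ w, kernelX nX zz.1 zz.2 w ∂μ) * ∫ w, kernelY nY zz.1 zz.2 w ∂μ) ^ 2‖ ≤ 1 := by
    intro zz
    rw [hval, norm_pow]
    refine pow_le_one₀ (norm_nonneg _) (abs_le.2 ⟨?_, ?_⟩)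
    · have h1 := mul_le_one₀ (measureReal_le_one (μ := μ.fst)
        (s := {w | nX (zz.1.1 - w) ≤ nX (zz.1.1 - zz.2.1)})) measureReal_nonneg
        (measureReal_le_one (μ := μ.snd) (s := {w | nY (zz.1.2 - w) ≤ nY (zz.1.2 - zz.2.2)}))
      have h2 : 0 ≤ μ.real ({w | nX (zz.1.1 - w) ≤ nX (zz.1.1 - zz.2.1)} ×ˢ
        {w | nY (zz.1.2 - w) ≤ nY (zz.1.2 - zz.2.2)}) := measureReal_nonneg
      linarith
    · have h1 : 0 ≤ μ.fst.real {w | nX (zz.1.1 - w) ≤ nX (zz.1.1 - zz.2.1)} *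
        μ.snd.real {w | nY (zz.1.2 - w) ≤ nY (zz.1.2 - zz.2.2)} := by positivity
      have h2 : μ.real ({w | nX (zz.1.1 - w) ≤ nX (zz.1.1 - zz.2.1)} ×ˢ
        {w | nY (zz.1.2 - w) ≤ nY (zz.1.2 - zz.2.2)}) ≤ 1 := measureReal_le_one
      linarith
  have hzero := (integral_eq_zero_iff_of_nonneg (fun _ => sq_nonneg _)
    (Integrable.of_bound hm.aestronglyMeasurable 1 (Eventually.of_forall hbd))).1 h0.symm
  refine eq_prod_of_measure_seminorm_ball_eq hnX hnY μ hac ?_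
  filter_upwards [Measure.ae_ae_of_ae_prod hzero] with z hz
  filter_upwards [hz] with z' hz'
  have h := hval (z, z')
  rw [pow_eq_zero_iff two_ne_zero |>.1 hz', eq_comm, sub_eq_zero, measureReal_def, measureReal_def,
    measureReal_def, ← ENNReal.toReal_mul] at h
  exact (ENNReal.toReal_eq_toReal_iff' (measure_ne_top _ _)
    (ENNReal.mul_ne_top (measure_ne_top _ _) (measure_ne_top _ _))).1 h

end Mean

section Consistency

variable {p q : ℕ} (nX : Seminorm ℝ (Fin p → ℝ)) (nY : Seminorm ℝ (Fin q → ℝ))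

/-- A sample at which the centred U-statistic is small has a small p-value. -/
lemma eventually_pValue_le {θ : ℝ} (hθ : 0 < θ) (hθ1 : θ ≤ 1) {α : ℝ} (hα : 0 < α) :
    ∀ᶠ N : ℕ in atTop, ∀ (x : Fin N → Fin p → ℝ) (y : Fin N → Fin q → ℝ),
      |∑ I : Fin 2 ⊕ Fin 4 → Fin N with Function.Injective I,
        (kernel nX nY (fun a => (x (I a), y (I a))) - θ)| < θ / 2 * (N : ℝ) ^ 6 →
      pValue nX nY x y ≤ α := by
  -- the loss from tuples with a repeated index is at most `72 * N ^ 5`, and `16 * 72 = 1152`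
  have hlarge : ∀ᶠ N : ℕ in atTop, (1152 + 2 / α) / (8 * θ) ≤ (N : ℝ) :=
    tendsto_natCast_atTop_atTop.eventually_ge_atTop _
  filter_upwards [hlarge, eventually_ge_atTop 4] with N hNl hN x y hdev
  have hN0 : (0 : ℝ) < N := by exact_mod_cast (by omega : 0 < N)
  rw [div_le_iff₀ (by positivity)] at hNl
  refine pValue_le nX nY x y hN hα (le_trans ?_ (le_T nX nY x y hN))
  have hcount : (N : ℝ) ^ 6 - 36 * (N : ℝ) ^ 5 ≤
      (Finset.univ.filter fun I : Fin 2 ⊕ Fin 4 → Fin N => Function.Injective I).card := by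
    have h := card_filter_not_injective (ι := Fin 2 ⊕ Fin 4) (N := N)
    have h6 : Fintype.card (Fin 2 ⊕ Fin 4) = 6 := by simp
    rw [h6] at h
    have h' : (N : ℝ) * (Finset.univ.filter fun I : Fin 2 ⊕ Fin 4 → Fin N =>
        ¬ Function.Injective I).card ≤ N * (36 * N ^ 5) := by
      refine le_trans (b := 6 ^ 2 * (N : ℝ) ^ 6) (by exact_mod_cast h) (le_of_eq (by ring))
    have hadd : ((Finset.univ.filter fun I : Fin 2 ⊕ Fin 4 → Fin N =>
        Function.Injective I).card : ℝ) + (Finset.univ.filter fun I : Fin 2 ⊕ Fin 4 → Fin N =>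
        ¬ Function.Injective I).card = (N : ℝ) ^ 6 := by
      have := Finset.card_filter_add_card_filter_not (s := Finset.univ)
        (fun I : Fin 2 ⊕ Fin 4 → Fin N => Function.Injective I)
      rw [Finset.card_univ, Fintype.card_fun, h6, Fintype.card_fin] at this
      exact_mod_cast this
    linarith [le_of_mul_le_mul_left h' hN0]
  rw [Finset.sum_sub_distrib, Finset.sum_const, nsmul_eq_mul] at hdev
  have hlow := (abs_lt.1 hdev).1
  have hsum : θ / 2 * (N : ℝ) ^ 6 - 72 * (N : ℝ) ^ 5 ≤
      ∑ I : Fin 2 ⊕ Fin 4 → Fin N with Function.Injective I,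
        kernel nX nY (fun a => (x (I a), y (I a))) - 36 * (N : ℝ) ^ 5 := by
    have h1 := mul_le_mul_of_nonneg_right hcount hθ.le
    have h2 : 36 * (N : ℝ) ^ 5 * θ ≤ 36 * (N : ℝ) ^ 5 := mul_le_of_le_one_right (by positivity) hθ1
    linarith
  calc 2 * (N : ℝ) ^ 2 / α = (N : ℝ) ^ 2 * (2 / α) := by ring
    _ ≤ (N : ℝ) ^ 2 * (N * (8 * θ) - 1152) :=
        mul_le_mul_of_nonneg_left (by linarith) (by positivity)
    _ = 16 / (N : ℝ) ^ 3 * (θ / 2 * (N : ℝ) ^ 6 - 72 * (N : ℝ) ^ 5) := by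
        field_simp
        ring
    _ ≤ _ := mul_le_mul_of_nonneg_left hsum (by positivity)

end Consistency

end RankTest

theorem theorem1 {p q : ℕ}
    (nX : Seminorm ℝ (Fin p → ℝ)) (hnX : ∀ v, nX v = 0 → v = 0)
    (nY : Seminorm ℝ (Fin q → ℝ)) (hnY : ∀ v, nY v = 0 → v = 0)
    {Ω₀ : Type*} [MeasurableSpace Ω₀] (P₀ : Measure Ω₀) [IsProbabilityMeasure P₀]
    (X : Ω₀ → Fin p → ℝ) (Y : Ω₀ → Fin q → ℝ) (hX : Measurable X) (hY : Measurable Y)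
    (hdep : ¬ IndepFun X Y P₀)
    (hcase : RankTest.ContinuousCase P₀ X Y ∨ RankTest.MixedCase P₀ X Y ∨
      RankTest.DiscreteCase P₀ X Y ∨ RankTest.DiscreteContinuousCase P₀ X Y)
    {Ω : Type*} [MeasurableSpace Ω] (P : Measure Ω) [IsProbabilityMeasure P]
    (x : ℕ → Ω → Fin p → ℝ) (y : ℕ → Ω → Fin q → ℝ)
    (hiid : iIndepFun (fun k ω => (x k ω, y k ω)) P)
    (hlaw : ∀ k, IdentDistrib (fun ω => (x k ω, y k ω)) (fun ω => (X ω, Y ω)) P P₀)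
    (α : ℝ) (hα₀ : 0 < α) (hα₁ : α < 1) :
    Tendsto (fun N : ℕ => P {ω | RankTest.pValue nX nY
        (fun k : Fin N => x k ω) (fun k : Fin N => y k ω) ≤ α})
      atTop (𝓝 1) := by
  have hXY : Measurable fun ω => (X ω, Y ω) := hX.prodMk hY
  set μ := P₀.map (fun ω => (X ω, Y ω)) with hμ
  have hprob : IsProbabilityMeasure μ := Measure.isProbabilityMeasure_map hXY.aemeasurable
  have hfst : μ.fst = P₀.map X := Measure.fst_map_prodMk hY
  have hsnd : μ.snd = P₀.map Y := Measure.snd_map_prodMk hX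
  have hac : μ ≪ μ.fst.prod μ.snd := by
    rw [hfst, hsnd]
    exact RankTest.map_prodMk_absolutelyContinuous_of_case hX hY hcase
  have hne : μ ≠ μ.fst.prod μ.snd := by
    rw [hfst, hsnd]
    exact fun h => hdep ((indepFun_iff_map_prod_eq_prod_map_map hX.aemeasurable
      hY.aemeasurable).2 h)
  have hθ := RankTest.integral_kernel_pos hnX hnY μ hac hne
  set θ := ∫ v, RankTest.kernel nX nY v ∂(Measure.pi fun _ => μ) with hθdef
  have hint : Integrable (RankTest.kernel nX nY) (Measure.pi fun _ => μ) :=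
    Integrable.of_bound (RankTest.measurable_kernel nX nY).aestronglyMeasurable 1
      (Eventually.of_forall fun v => RankTest.abs_kernel_le nX nY v)
  have hθ1 : θ ≤ 1 :=
    (integral_mono hint (integrable_const 1) fun v =>
      (abs_le.1 (RankTest.abs_kernel_le nX nY v)).2).trans (by simp)
  have h0 : ∫ v, (RankTest.kernel nX nY v - θ) ∂(Measure.pi fun _ => μ) = 0 := by
    rw [integral_sub hint (integrable_const θ), ← hθdef]
    simp
  have hbad := RankTest.tendsto_measure_sum_injective (fun k => (hlaw k).aemeasurable_fst) hiid
    (fun k => (hlaw k).map_eq) ((RankTest.measurable_kernel nX nY).sub_const θ) (K := 1 + θ)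
    (fun w => (abs_sub _ _).trans (add_le_add (RankTest.abs_kernel_le nX nY w)
      (abs_of_pos hθ).le)) h0 (half_pos hθ)
  have hbad' := ENNReal.tendsto_ofReal hbad
  rw [ENNReal.ofReal_zero] at hbad'
  have hlim := ENNReal.Tendsto.sub (tendsto_const_nhds (x := (1 : ℝ≥0∞)) (f := atTop)) hbad'
    (Or.inl ENNReal.one_ne_top)
  rw [tsub_zero] at hlim
  refine tendsto_of_tendsto_of_tendsto_of_le_of_le' hlim tendsto_const_nhds ?_
    (Eventually.of_forall fun N => prob_le_one)
  filter_upwards [RankTest.eventually_pValue_le nX nY hθ hθ1 hα₀] with N hN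
  rw [ofReal_measureReal, tsub_le_iff_right, ← measure_univ (μ := P)]
  refine (measure_mono fun ω _ => ?_).trans (measure_union_le _ _)
  rcases lt_or_ge |∑ I : Fin 2 ⊕ Fin 4 → Fin N with Function.Injective I,
      (RankTest.kernel nX nY (fun a => (x (I a) ω, y (I a) ω)) - θ)| (θ / 2 * (N : ℝ) ^ 6)
    with h | h
  · exact Or.inl (hN _ _ h)
  · refine Or.inr (le_trans (le_of_eq ?_) h)
    simp
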